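/- Let $T$ be a complete first-order theory in a language $L$ without function symbols of positive arity, and let $P$ be a unary predicate of $L$. For $M\models T$ let $P^M$ denote the set defined by $P$ in $M$, also viewed as a structure for the relation symbols of $L$. Assume that in all models $M$ of $T$: $P^M$ is infinite; every subset of a power of $P^M$ definable in $M$ with parameters is definable in $M$ with parameters from $P^M$; every subset of a power of $P^M$ definable in $M$ without parameters is definable without parameters in the structure $P^M$; and, modulo $T$, every formula in $n\ge 1$ free variables is equivalent to an $n$-ary predicate of $L$. Put $|T|=|L|+\aleph_0$. A subset $A$ of a model $N$ of $T$ is *complete* if for every formula $\psi(\bar x,\bar y)$ and every tuple $\bar b$ from $A$, if $N\models\psi(\bar a,\bar b)$ for some tuple $\bar a$ from $P^N$, then $N\models\psi(\bar a',\bar b)$ for some tuple $\bar a'$ from $P^N\cap A$. For $M\models T$, $S_*(M)$ is the set of all types $\mathrm{tp}(\bar c/M)$, where $\bar c$ is a finite tuple in an elementary extension $N$ of $M$, such that $P^N\cap(M\cup\bar c)=P^N\cap M$ and $M\cup\bar c$ is complete in $N$. The theory $T$ is *nulldimensional over $P$* if for every $M\models T$ every $p\in S_*(M)$ is realized in $M$.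 A class $K$ of models of $T$ is *categorical over $P$* if for all $M_1,M_2\in K$ with $P^{M_1}=P^{M_2}$ (as structures) there is an isomorphism from $M_1$ onto $M_2$ that is the identity on $P^{M_1}$. Let $\lambda>|T|$ be a cardinal with $\lambda=\lambda^{<\lambda}$. Then the following are equivalent: 1. $T$ is nulldimensional over $P$. 2. Every $M\models T$ whose $P$-part $P^M$ is saturated of cardinality $\lambda$ is itself saturated of cardinality $\lambda$. 3. The class of all $M\models T$ with $P^M$ saturated of cardinality $\lambda$ is categorical over $P$. 4. For every cardinal $\mu>|T|$ with $\mu=\mu^{<\mu}$, every $M\models T$ with $P^M$ saturated of cardinality $\mu$ is itself saturated of cardinality $\mu$. 5. The class of all $M\models T$ such that $P^M$ is saturated of cardinality $\mu$ for some cardinal $\mu>|T|$ with $\mu=\mu^{<\mu}$ is categorical over $P$. -/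

import Mathlib

open FirstOrder FirstOrder.Language Cardinal

universe u

namespace OverPredicate

/-- The cardinal `|T|` of a theory in the language `L`: the number of symbols of `L` plus `ℵ₀`,
i.e. the number of `L`-formulas. -/
noncomputable def theoryCard (L : FirstOrder.Language.{u, u}) : Cardinal.{u} := max ℵ₀ L.card

/-- The relation symbols of `L`, without its function and constant symbols. -/
def relPart (L : FirstOrder.Language.{u, u}) : FirstOrder.Language.{u, u} := ⟨fun _ => PEmpty, L.Relations⟩

/-- Every subset `A` of an `L`-structure `M`, viewed as the substructure `M|_A`
(for the relation symbols of `L`). -/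
instance relRestrict {L : FirstOrder.Language.{u, u}} {M : Type u} [L.Structure M] (A : Set M) :
    (relPart L).Structure A where
  funMap f _ := f.elim
  RelMap {n} (R : L.Relations n) v := Structure.RelMap (L := L) R (fun i => (v i : M))

variable {L : FirstOrder.Language.{u, u}}

/-- The set `P^M`; as an `(relPart L)`-structure it is the `P`-part `M|_P` of `M`. -/
def predSet (P : L.Relations 1) (M : Type u) [L.Structure M] : Set M :=
  {x | Structure.RelMap P ![x]}

/-- The type of the tuple `c` over the parameters `g a`, `a ∈ A`. A formula with free variables in
`A ⊕ Fin n` is read as a formula in `n` variables with parameters from `A`. -/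
def typeOver {M A : Type u} [L.Structure M] {n : ℕ} (g : A → M) (c : Fin n → M) :
    Set (L.Formula (A ⊕ Fin n)) :=
  {φ | φ.Realize (Sum.elim g c)}

/-- `M` is `κ`-saturated: every set of formulas in one variable, with parameters from a
set `A ⊆ M` of cardinality `< κ`, that is finitely satisfiable in `M` is realized in `M`. -/
def IsKappaSaturated (L : FirstOrder.Language.{u, u}) (κ : Cardinal.{u}) (M : Type u) [L.Structure M] :
    Prop :=
  ∀ A : Set M, #A < κ → ∀ p : Set (L.Formula (A ⊕ Fin 1)),
    (∀ q : Finset (L.Formula (A ⊕ Fin 1)), (q : Set (L.Formula (A ⊕ Fin 1))) ⊆ p →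
      ∃ c : Fin 1 → M, (q : Set (L.Formula (A ⊕ Fin 1))) ⊆ typeOver (fun a : A => (a : M)) c) →
    ∃ c : Fin 1 → M, p ⊆ typeOver (fun a : A => (a : M)) c

/-- `M` is saturated of cardinality `κ`. -/
def IsSaturatedOfCard (L : FirstOrder.Language.{u, u}) (κ : Cardinal.{u}) (M : Type u) [L.Structure M] :
    Prop :=
  #M = κ ∧ IsKappaSaturated L κ M

/-- The subset `A` of `N` is complete: whenever `ψ(x̄, b̄)`, with `b̄` in `A`, has a solution in `P`,
it has one in `P ∩ A`. -/
def IsCompleteSet (P : L.Relations 1) {N : Type u} [L.Structure N] (A : Set N) : Prop :=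
  ∀ (m k : ℕ) (ψ : L.Formula (Fin m ⊕ Fin k)) (b : Fin k → N), (∀ j, b j ∈ A) →
    (∃ a : Fin m → N, (∀ i, a i ∈ predSet P N) ∧ ψ.Realize (Sum.elim a b)) →
    ∃ a : Fin m → N, (∀ i, a i ∈ predSet P N ∩ A) ∧ ψ.Realize (Sum.elim a b)

/-- `S_*(M)` in `n` variables: the types `tp(c̄/M)`, for `c̄` in an elementary extension of `M`,
such that `P ∩ (M ∪ c̄) = P ∩ M` and `M ∪ c̄` is complete. -/
def starTypes (P : L.Relations 1) (M : Type u) [L.Structure M] (n : ℕ) :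
    Set (Set (L.Formula (M ⊕ Fin n))) :=
  {p | ∃ (N : Type u) (_ : L.Structure N) (f : M ↪ₑ[L] N) (c : Fin n → N),
    p = typeOver f c ∧
    predSet P N ∩ (Set.range f ∪ Set.range c) = predSet P N ∩ Set.range f ∧
    IsCompleteSet P (Set.range f ∪ Set.range c)}

/-- `T` is nulldimensional over `P`: for every model `M` of `T`, every type in `S_*(M)` is
realized in `M`. -/
def Nulldimensional (T : L.Theory) (P : L.Relations 1) : Prop :=
  ∀ (M : Theory.ModelType.{u, u, u} T) (n : ℕ), ∀ p ∈ starTypes P M n,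
    ∃ d : Fin n → M, p = typeOver (fun m : M => m) d

/-- The class `K` of models of `T` is categorical over `P`: if `M₁, M₂ ∈ K` have the same
`P`-part (identified along `e`), then they are isomorphic over `P`. -/
def CategoricalOver (T : L.Theory) (P : L.Relations 1)
    (K : Set (Theory.ModelType.{u, u, u} T)) : Prop :=
  ∀ M₁ ∈ K, ∀ M₂ ∈ K, ∀ e : predSet P M₁ ≃[relPart L] predSet P M₂,
    ∃ g : M₁ ≃[L] M₂, ∀ x : predSet P M₁, g (x : M₁) = (e x : M₂)

/-- The models of `T` whose `P`-part is saturated of cardinality `κ`. -/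
def satPartModels (T : L.Theory) (P : L.Relations 1) (κ : Cardinal.{u}) :
    Set (Theory.ModelType.{u, u, u} T) :=
  {M | IsSaturatedOfCard (relPart L) κ (predSet P M)}

/-- The standing assumptions on a complete theory `T` and a unary predicate `P`. -/
structure StandingAssumptions (T : L.Theory) (P : L.Relations 1) : Prop where
  /-- `T` is complete (and consistent). -/
  complete : T.IsComplete
  /-- There are no function symbols (of positive arity). -/
  no_functions : ∀ n : ℕ, IsEmpty (L.Functions (n + 1))
  /-- `P` is infinite. -/
  infinite : ∀ M : Theory.ModelType.{u, u, u} T, (predSet P M).Infinite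
  /-- `P` is stably embedded: a subset of a power of `P` that is definable with parameters is
  definable with parameters from `P`. -/
  stably_embedded : ∀ (M : Theory.ModelType.{u, u, u} T) (n : ℕ) (D : Set (Fin n → M)),
    (∀ v ∈ D, ∀ i, v i ∈ predSet P M) →
    (Set.univ : Set M).Definable L D → (predSet P M).Definable L D
  /-- A subset of a power of `P` that is definable in `M` without parameters is definable
  without parameters in the structure `M|_P`. -/
  induced : ∀ (M : Theory.ModelType.{u, u, u} T) (n : ℕ) (D : Set (Fin n → M)),
    (∀ v ∈ D, ∀ i, v i ∈ predSet P M) →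
    (∅ : Set M).Definable L D →
    (∅ : Set (predSet P M)).Definable (relPart L)
      {v : Fin n → predSet P M | (fun i => (v i : M)) ∈ D}
  /-- Quantifier elimination down to the level of predicates: modulo `T` every formula in
  `n + 1` variables is equivalent to `R(x₀, …, xₙ)` for some relation symbol `R`. -/
  qe : ∀ (n : ℕ) (φ : L.Formula (Fin (n + 1))), ∃ R : L.Relations (n + 1),
    φ ⇔[T] (R.formula (fun i => Term.var i) : L.Formula (Fin (n + 1)))

end OverPredicate

namespace OverPredicate

/-! The working notion is `PMeets P A B`: for B ⊆ A ∩ P it says that A is complete and P ∩ A = B.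
Types in S_*(M) are those of tuples c̄ for which M ∪ c̄ has this property with B = P ∩ M.

One construction, `PCompact.exists_decides`, serves both main directions. Suppose |A| ≤ κ, and that
fewer than κ A-definable conditions that are finitely satisfiable in P always have a common solution
in B. Then fewer than κ consistent A-definable conditions extend to a consistent family which
decides, for each A-definable E(z, x), whether some z in P satisfies it, naming a witness in B if
so. By `Decides.pMeets`, adjoining a realization c of that family keeps the set complete without new
points of P.

Nulldimensionality gives saturation: when P^M is saturated, the construction applies with A = M and
B = P^M, so a small consistent family over M extends to a type in S_*(M), which is realized in M.
The cardinality is right because an elementary submodel containing P^M realizes the type of each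
point of M over it, hence contains that point.

Saturation gives categoricity by back and forth over an isomorphism of P-parts. Every partial map
has all of P in its domain, which is too large for a direct use of saturation. Stable embeddedness
replaces the truth of each formula on P by a single definition over P, leaving fewer than κ
conditions on the image of a new point (`exists_elemRel_insert`).

Categoricity gives nulldimensionality by contraposition. A failure yields a model and a point c
outside it over which P does not grow. This is first-order in a language naming the small model, so
the pair may be replaced by one whose small model M is saturated, of size at most λ
(`exists_compact_pair`). In a large λ⁺-compact elementary extension of M, take a maximal elementary
submodel containing M with no new points of P. Categoricity makes it isomorphic to M, so the type of
c can be copied over it, and repeated use of the deciding construction closes the copied point off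
to a strictly larger such submodel, a contradiction (`not_categoricalOver`). -/

/-- Transfinite completion of a set: if every good set of cardinality less than `κ` can be enlarged
by one element to a good set settling a given task, then some good set settles all `κ` tasks. -/
theorem exists_good_all_done {α ι : Type u} {κ : Cardinal.{u}} (hι : #ι ≤ κ)
    (Good : Set α → Prop) (Done : ι → Set α → Prop)
    (mono : ∀ t A B, A ⊆ B → Done t A → Done t B)
    (chain : ∀ C : Set (Set α), C.Nonempty → IsChain (· ⊆ ·) C → (∀ A ∈ C, Good A) → Good (⋃₀ C))
    (step : ∀ A, Good A → #A < κ → ∀ t, Done t A ∨ ∃ a, Good (insert a A) ∧ Done t (insert a A))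
    (h0 : Good ∅) : ∃ A, Good A ∧ #A ≤ κ ∧ ∀ t, Done t A := by
  classical
  obtain ⟨r, wo, hr⟩ := Cardinal.exists_ord_eq ι
  let _ : LinearOrder ι := linearOrderOfSTO r
  have wf : WellFounded ((· < ·) : ι → ι → Prop) := wo.wf
  have hseg : ∀ t : ι, #{s // s < t} < κ := by
    intro t
    have h := Ordinal.typein_lt_type r t
    rw [← hr, Cardinal.lt_ord] at h
    exact lt_of_lt_of_le h hι
  let pick : Set α → ι → Set α := fun A t =>
    if h : ¬ Done t A ∧ ∃ a, Good (insert a A) ∧ Done t (insert a A) then {h.2.choose} else ∅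
  have pick_card : ∀ A t, #(pick A t) ≤ 1 := by
    intro A t
    simp only [pick]
    split_ifs <;> simp
  have pick_spec : ∀ A t, Good A → #A < κ → Good (A ∪ pick A t) ∧ Done t (A ∪ pick A t) := by
    intro A t hA hc
    by_cases hd : Done t A
    · simp [pick, hd, hA]
    · have h := (step A hA hc t).resolve_left hd
      have h' : ¬ Done t A ∧ ∃ a, Good (insert a A) ∧ Done t (insert a A) := ⟨hd, h⟩
      simp only [pick, dif_pos h', Set.union_singleton]
      exact h.choose_spec
  -- Only the points added at each stage are stored. The set U t reached before stage t therefore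
  -- has at most as many points as t has predecessors, which is fewer than κ also at limit stages.
  let B : ι → Set α := wf.fix fun t B => pick (⋃ s : {s // s < t}, B s.1 s.2) t
  let U : ι → Set α := fun t => ⋃ s : {s // s < t}, B s.1
  have hB : ∀ t, B t = pick (U t) t := fun t => wf.fix_eq _ t
  have B_card : ∀ t, #(B t) ≤ 1 := fun t => by rw [hB]; exact pick_card _ _
  have U_card : ∀ t, #(U t) < κ := by
    intro t
    refine lt_of_le_of_lt ?_ (hseg t)
    refine (Cardinal.mk_iUnion_le_sum_mk).trans ?_
    refine (Cardinal.sum_le_sum _ (fun _ => 1) fun s : {s // s < t} => B_card s.1).trans ?_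
    simp
  -- Writing the union over an initial segment as the union of a chain lets `chain` handle limit
  -- stages and the final union alike.
  have U_union : ∀ J : Set ι, (∀ t ∈ J, ∀ s < t, s ∈ J) →
      (⋃ s ∈ J, B s) = ⋃₀ ((fun s => U s ∪ B s) '' J) := by
    intro J hJ
    ext x
    simp only [Set.mem_iUnion, Set.mem_sUnion, Set.exists_mem_image, Set.mem_union, U]
    constructor
    · rintro ⟨s, hs, hx⟩
      exact ⟨s, hs, Or.inr hx⟩
    · rintro ⟨s, hs, ⟨s', hx⟩ | hx⟩
      · exact ⟨s'.1, hJ s hs _ s'.2, hx⟩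
      · exact ⟨s, hs, hx⟩
  have UB_mono : Monotone fun s => U s ∪ B s := by
    intro s t hst x hx
    rcases hst.eq_or_lt with rfl | hlt
    · exact hx
    · left
      rcases hx with hx | hx
      · obtain ⟨s', hx⟩ := Set.mem_iUnion.1 hx
        exact Set.mem_iUnion.2 ⟨⟨s'.1, s'.2.trans hlt⟩, hx⟩
      · exact Set.mem_iUnion.2 ⟨⟨s, hlt⟩, hx⟩
  have good_union : ∀ J : Set ι, (∀ t ∈ J, ∀ s < t, s ∈ J) → (∀ s ∈ J, Good (U s ∪ B s)) →
      Good (⋃ s ∈ J, B s) := by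
    intro J hJ hg
    rcases J.eq_empty_or_nonempty with rfl | hne
    · simpa using h0
    · rw [U_union J hJ]
      refine chain _ (hne.image _) ?_ ?_
      · rintro _ ⟨s, _, rfl⟩ _ ⟨t, _, rfl⟩ _
        rcases le_total s t with h | h
        · exact Or.inl (UB_mono h)
        · exact Or.inr (UB_mono h)
      · rintro _ ⟨s, hs, rfl⟩
        exact hg s hs
  have main : ∀ t, Good (U t ∪ B t) ∧ Done t (U t ∪ B t) := by
    intro t
    induction t using wf.induction with
    | _ t ih =>
      rw [hB]
      refine pick_spec _ _ ?_ (U_card t)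
      have := good_union {s | s < t} (fun a ha s hs => lt_trans hs ha) (fun s hs => (ih s hs).1)
      have e : U t = ⋃ s ∈ {s | s < t}, B s := by
        ext x; simp [U]
      rw [e]
      exact this
  refine ⟨⋃ s, B s, ?_, ?_, fun t => mono t _ _ ?_ (main t).2⟩
  · have := good_union Set.univ (fun _ _ _ _ => trivial) (fun s _ => (main s).1)
    simpa using this
  · refine (Cardinal.mk_iUnion_le_sum_mk).trans ?_
    exact (Cardinal.sum_le_sum _ (fun _ => 1) fun s => B_card s).trans (by simpa using hι)
  · refine Set.union_subset (Set.iUnion_subset fun s => Set.subset_iUnion B s.1)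
      (Set.subset_iUnion B t)

/-! ### Counting formulas and closure properties of definable sets -/

section Formulas

variable {L : FirstOrder.Language.{u, u}}

theorem mk_formula_le {α : Type u} : #(L.Formula α) ≤ max (theoryCard L) #α := by
  have h := BoundedFormula.card_le (L := L) (α := α)
  have h1 : #(L.Formula α) ≤ #(Σ n, L.BoundedFormula α n) :=
    Cardinal.mk_le_of_injective (f := fun φ => (⟨0, φ⟩ : Σ n, L.BoundedFormula α n))
      (fun φ ψ h => by simpa using h)
  refine (h1.trans h).trans ?_
  simp only [Cardinal.lift_id, theoryCard]
  rw [max_le_iff]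
  refine ⟨le_max_of_le_left (le_max_left _ _), ?_⟩
  refine (Cardinal.add_le_max _ _).trans ?_
  rw [max_le_iff, max_le_iff]
  exact ⟨⟨le_max_right _ _, le_max_of_le_left (le_max_right _ _)⟩,
    le_max_of_le_left (le_max_left _ _)⟩

theorem mk_formula_sum_le {α : Type u} {n : ℕ} :
    #(L.Formula (α ⊕ Fin n)) ≤ max (theoryCard L) #α := by
  refine mk_formula_le.trans ?_
  rw [max_le_iff]
  refine ⟨le_max_left _ _, ?_⟩
  rw [Cardinal.mk_sum]
  simp only [Cardinal.mk_fin, Cardinal.lift_natCast, Cardinal.lift_uzero]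
  refine (Cardinal.add_le_max _ _).trans ?_
  have h0 : ℵ₀ ≤ theoryCard L := le_max_left _ _
  rw [max_le_iff, max_le_iff]
  exact ⟨⟨le_max_right _ _, le_max_of_le_left ((Cardinal.natCast_lt_aleph0).le.trans h0)⟩,
    le_max_of_le_left h0⟩

variable {M : Type u} [L.Structure M]

theorem mk_definable_le {A : Set M} {n : ℕ} :
    #{D : Set (Fin n → M) | A.Definable L D} ≤ max (theoryCard L) #A := by
  refine le_trans ?_ (mk_formula_sum_le (L := L) (α := A) (n := n))
  refine Cardinal.mk_le_of_surjective
    (f := fun φ : L.Formula (A ⊕ Fin n) =>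
      (⟨{v | φ.Realize (Sum.elim (↑) v)}, Set.definable_iff_exists_formula_sum.2 ⟨φ, rfl⟩⟩ :
        {D : Set (Fin n → M) | A.Definable L D})) ?_
  rintro ⟨D, hD⟩
  obtain ⟨φ, rfl⟩ := Set.definable_iff_exists_formula_sum.1 hD
  exact ⟨φ, rfl⟩

theorem definable_of_formula {α β : Type*} {A : Set M} (φ : L.Formula (β ⊕ α)) (b : β → M)
    (hb : ∀ i, b i ∈ A) : A.Definable L {v : α → M | φ.Realize (Sum.elim b v)} := by
  refine Set.definable_iff_exists_formula_sum.2
    ⟨φ.relabel (Sum.map (fun i => ⟨b i, hb i⟩) id), ?_⟩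
  ext v
  simp only [Set.mem_ofPred_eq, Formula.realize_relabel]
  rw [Sum.elim_comp_map]
  rfl

theorem definable₁_iff {A : Set M} {D : Set M} :
    A.Definable₁ L D ↔ ∃ φ : L.Formula (A ⊕ Fin 1),
      D = {x | φ.Realize (Sum.elim (↑) fun _ => x)} := by
  rw [Set.Definable₁, Set.definable_iff_exists_formula_sum]
  refine exists_congr fun φ => ⟨fun h => ?_, fun h => ?_⟩
  · ext x
    exact Set.ext_iff.1 h (fun _ => x)
  · subst h
    ext v
    have : v = fun _ => v 0 := funext fun i => by rw [Subsingleton.elim i 0]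
    rw [this]
    rfl

theorem mk_definable₁_le {A : Set M} :
    #{D : Set M | A.Definable₁ L D} ≤ max (theoryCard L) #A := by
  refine le_trans (Cardinal.mk_le_of_injective
    (f := fun D : {D : Set M | A.Definable₁ L D} =>
      (⟨{x : Fin 1 → M | x 0 ∈ D.1}, D.2⟩ : {D : Set (Fin 1 → M) | A.Definable L D})) ?_)
    mk_definable_le
  rintro ⟨D, hD⟩ ⟨D', hD'⟩ h
  have h := Subtype.ext_iff.1 h
  refine Subtype.ext (Set.ext fun x => ?_)
  exact Set.ext_iff.1 h (fun _ => x)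

theorem mk_definable₂_le {A : Set M} :
    #{D : Set (M × M) | A.Definable₂ L D} ≤ max (theoryCard L) #A := by
  refine le_trans (Cardinal.mk_le_of_injective
    (f := fun D : {D : Set (M × M) | A.Definable₂ L D} =>
      (⟨{x : Fin 2 → M | (x 0, x 1) ∈ D.1}, D.2⟩ : {D : Set (Fin 2 → M) | A.Definable L D})) ?_)
    mk_definable_le
  rintro ⟨D, hD⟩ ⟨D', hD'⟩ h
  have h := Subtype.ext_iff.1 h
  refine Subtype.ext (Set.ext fun x => ?_)
  exact Set.ext_iff.1 h ![x.1, x.2]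

theorem definable₁_sInter {A : Set M} {G : Set (Set M)} (hG : G.Finite)
    (h : ∀ D ∈ G, A.Definable₁ L D) : A.Definable₁ L (⋂₀ G) := by
  have := hG.to_subtype
  have e : {x : Fin 1 → M | x 0 ∈ ⋂₀ G} = ⋂ D : G, {x : Fin 1 → M | x 0 ∈ D.1} := by
    ext x; simp
  rw [Set.Definable₁, e]
  exact Set.definable_iInter_of_finite fun D => h D D.2

theorem definable₁_compl {A D : Set M} (h : A.Definable₁ L D) : A.Definable₁ L Dᶜ :=
  Set.Definable.compl h

theorem definable₁_inter {A D E : Set M} (h : A.Definable₁ L D) (h' : A.Definable₁ L E) :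
    A.Definable₁ L (D ∩ E) :=
  Set.Definable.inter h h'

theorem definable₁_predSet {A : Set M} (P : L.Relations 1) : A.Definable₁ L (predSet P M) := by
  refine definable₁_iff.2 ⟨P.formula₁ (Term.var (Sum.inr 0)), ?_⟩
  ext x
  simp [predSet, Formula.realize_rel₁]

/-- Projection to the first coordinate along a definable set. -/
theorem definable₁_exists {A : Set M} {E : Set (M × M)} {D : Set M} (hE : A.Definable₂ L E)
    (hD : A.Definable₁ L D) : A.Definable₁ L {z | ∃ x ∈ D, (z, x) ∈ E} := by
  have h1 : A.Definable L {v : Fin 2 → M | v 1 ∈ D} := hD.preimage_comp (fun _ : Fin 1 => (1 : Fin 2))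
  have h2 := (Set.Definable.inter h1 hE).image_comp (fun _ : Fin 1 => (0 : Fin 2))
  have e : {v : Fin 1 → M | v 0 ∈ {z | ∃ x ∈ D, (z, x) ∈ E}} =
      (fun g : Fin 2 → M => g ∘ fun _ : Fin 1 => (0 : Fin 2)) ''
        ({v : Fin 2 → M | v 1 ∈ D} ∩ {v | (v 0, v 1) ∈ E}) := by
    ext v
    constructor
    · rintro ⟨x, hx, hE⟩
      refine ⟨![v 0, x], ⟨hx, hE⟩, ?_⟩
      funext i
      rw [Subsingleton.elim i 0]
      rfl
    · rintro ⟨w, ⟨h1, h2⟩, rfl⟩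
      exact ⟨w 1, h1, h2⟩
  rw [Set.Definable₁, e]
  exact h2

theorem definable₂_swap {A : Set M} {E : Set (M × M)} (hE : A.Definable₂ L E) :
    A.Definable₂ L {v | (v.2, v.1) ∈ E} :=
  Set.Definable.preimage_comp (![1, 0] : Fin 2 → Fin 2) hE

theorem definable₁_section {A : Set M} {E : Set (M × M)} (hE : A.Definable₂ L E) {d : M}
    (hd : d ∈ A) : A.Definable₁ L {x | (d, x) ∈ E} := by
  have h := definable₁_exists (definable₂_swap hE) (Set.Definable.singleton_of_mem L hd)
  simpa using h

end Formulas

/-! ### Compactness, and saturation phrased through families of definable sets -/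

section Compactness

variable {L : FirstOrder.Language.{u, u}}

theorem realize_congr_freeVar {α : Type u} [DecidableEq α] {M : Type u} [L.Structure M]
    (φ : L.Formula α) {v w : α → M} (h : ∀ a ∈ φ.freeVarFinset, v a = w a) :
    φ.Realize v ↔ φ.Realize w := by
  have hv := BoundedFormula.realize_restrictFreeVar (φ := φ) (f := id) (v := fun a => v a)
    (xs := default) v (fun _ => rfl)
  have hw := BoundedFormula.realize_restrictFreeVar (φ := φ) (f := id) (v := fun a => v a)
    (xs := default) w (fun a => h a a.2)
  exact hv.symm.trans hw

/-- Compactness for sets of formulas. -/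
theorem exists_realize_of_finite {X : Type u} [Nonempty X] (Γ : Set (L.Formula X))
    (h : ∀ F : Finset (L.Formula X), (F : Set (L.Formula X)) ⊆ Γ →
      ∃ (N : Type u) (_ : L.Structure N) (v : X → N), ∀ φ ∈ F, φ.Realize v) :
    ∃ (N : Type u) (_ : L.Structure N) (v : X → N), ∀ φ ∈ Γ, φ.Realize v := by
  classical
  let T : L[[X]].Theory := Formula.equivSentence '' Γ
  have hT : T.IsSatisfiable := by
    rw [Theory.isSatisfiable_iff_isFinitelySatisfiable]
    intro T0 hT0
    obtain ⟨N, _, v, hv⟩ := h (T0.image Formula.equivSentence.symm) (by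
      intro φ hφ
      obtain ⟨ψ, hψ, rfl⟩ := Finset.mem_image.1 hφ
      obtain ⟨χ, hχ, rfl⟩ := hT0 hψ
      simpa using hχ)
    let _ := constantsOn.structure v
    have : Nonempty N := ⟨v (Classical.arbitrary X)⟩
    have hm : N ⊨ (T0 : L[[X]].Theory) := by
      refine ⟨fun ψ hψ => ?_⟩
      exact (Formula.realize_equivSentence_symm N ψ v).1 (hv _ (Finset.mem_image_of_mem _ hψ))
    exact Theory.Model.isSatisfiable N
  obtain ⟨K⟩ := hT
  let i : L.Structure K := (L.lhomWithConstants X).reduct K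
  refine ⟨K, i, fun a => (L.con a : K), fun φ hφ => ?_⟩
  exact (Formula.realize_equivSentence K φ).1
    (Theory.realize_sentence_of_mem T (Set.mem_image_of_mem _ hφ))

variable {M N : Type u} [L.Structure M] [L.Structure N]

/-- A map preserving all formulas is an elementary embedding. -/
def elementaryOfFormulas (f : M → N) (h : ∀ φ : L.Formula M, φ.Realize id → φ.Realize f) :
    M ↪ₑ[L] N where
  toFun := f
  map_formula' n φ x := by
    have h1 := h (φ.relabel x)
    have h2 := h (φ.relabel x).not
    simp only [Formula.realize_relabel, Formula.realize_not, Function.id_comp] at h1 h2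
    exact ⟨fun h' => by_contra fun h'' => h2 h'' h', h1⟩

/-- Compactness for p together with the elementary diagram of M. -/
theorem exists_elementary_extension_realizing [Nonempty M] {n : ℕ}
    (p : Set (L.Formula (M ⊕ Fin n)))
    (h : ∀ F : Finset (L.Formula (M ⊕ Fin n)), (F : Set (L.Formula (M ⊕ Fin n))) ⊆ p →
      ∃ c : Fin n → M, ∀ φ ∈ F, φ.Realize (Sum.elim id c)) :
    ∃ (N : Type u) (_ : L.Structure N) (f : M ↪ₑ[L] N) (c : Fin n → N),
      ∀ φ ∈ p, φ.Realize (Sum.elim f c) := by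
  classical
  let Γ : Set (L.Formula (M ⊕ Fin n)) :=
    p ∪ (Formula.relabel Sum.inl) '' {φ : L.Formula M | φ.Realize id}
  obtain ⟨N, _, v, hv⟩ := exists_realize_of_finite Γ (by
    intro F hF
    obtain ⟨c, hc⟩ := h (F.filter (· ∈ p)) (by intro φ hφ; simp at hφ; exact hφ.2)
    refine ⟨M, inferInstance, Sum.elim id c, fun φ hφ => ?_⟩
    rcases hF hφ with h1 | ⟨ψ, h1, rfl⟩
    · exact hc φ (by simp [hφ, h1])
    · rw [Formula.realize_relabel, Sum.elim_comp_inl]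
      exact h1)
  refine ⟨N, inferInstance, elementaryOfFormulas (v ∘ Sum.inl) fun φ hφ => ?_, v ∘ Sum.inr,
    fun φ hφ => ?_⟩
  · have := hv _ (Or.inr (Set.mem_image_of_mem _ hφ))
    rwa [Formula.realize_relabel] at this
  · have := hv _ (Or.inl hφ)
    rwa [← Sum.elim_comp_inl_inr v] at this

/-- Every family of fewer than `κ` definable subsets of `M` with the finite intersection property
has a common point. -/
def DefCompact (L : FirstOrder.Language.{u, u}) (κ : Cardinal.{u}) (M : Type u) [L.Structure M] :
    Prop :=
  ∀ F : Set (Set M), #F < κ → (∀ D ∈ F, (Set.univ : Set M).Definable₁ L D) →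
    (∀ G ⊆ F, G.Finite → (⋂₀ G).Nonempty) → (⋂₀ F).Nonempty

theorem defCompact_of_formulas {κ : Cardinal.{u}}
    (h : ∀ p : Set (L.Formula (M ⊕ Fin 1)), #p < κ →
      (∀ q : Finset (L.Formula (M ⊕ Fin 1)), (q : Set (L.Formula (M ⊕ Fin 1))) ⊆ p →
        ∃ c : M, ∀ φ ∈ q, φ.Realize (Sum.elim id fun _ => c)) →
      ∃ c : M, ∀ φ ∈ p, φ.Realize (Sum.elim id fun _ => c)) : DefCompact L κ M := by
  classical
  intro F hF hD hG
  have key : ∀ D : F, ∃ φ : L.Formula (M ⊕ Fin 1),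
      D.1 = {x | φ.Realize (Sum.elim id fun _ => x)} := by
    intro D
    obtain ⟨φ, hφ⟩ := definable₁_iff.1 (hD D D.2)
    refine ⟨φ.relabel (Sum.map (↑) id), ?_⟩
    rw [hφ]
    ext x
    simp only [Set.mem_ofPred_eq, Formula.realize_relabel, Sum.elim_comp_map]
    rfl
  choose φ hφ using key
  obtain ⟨c, hc⟩ := h (Set.range φ) (Cardinal.mk_range_le.trans_lt hF) (by
    intro q hq
    have : ∀ ψ : q, ∃ D, φ D = ψ.1 := fun ψ => hq ψ.2
    choose d hd using this
    obtain ⟨c, hc⟩ := hG (Set.range fun ψ => (d ψ).1)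
      (by rintro _ ⟨ψ, rfl⟩; exact (d ψ).2) (Set.finite_range _)
    refine ⟨c, fun ψ hψ => ?_⟩
    have h1 := hc _ ⟨⟨ψ, hψ⟩, rfl⟩
    have h2 := (Set.ext_iff.1 (hφ (d ⟨ψ, hψ⟩)) c).1 h1
    rwa [hd] at h2)
  refine ⟨c, fun D hD => ?_⟩
  have := hc _ ⟨⟨D, hD⟩, rfl⟩
  exact (Set.ext_iff.1 (hφ ⟨D, hD⟩) c).2 this

theorem DefCompact.exists_realize {κ : Cardinal.{u}} (hM : DefCompact L κ M)
    {α : Type u} (g : α → M) (p : Set (L.Formula (α ⊕ Fin 1))) (hp : #p < κ)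
    (h : ∀ q : Finset (L.Formula (α ⊕ Fin 1)), (q : Set (L.Formula (α ⊕ Fin 1))) ⊆ p →
      ∃ c : M, ∀ φ ∈ q, φ.Realize (Sum.elim g fun _ => c)) :
    ∃ c : M, ∀ φ ∈ p, φ.Realize (Sum.elim g fun _ => c) := by
  classical
  let S : L.Formula (α ⊕ Fin 1) → Set M := fun φ => {x | φ.Realize (Sum.elim g fun _ => x)}
  obtain ⟨c, hc⟩ := hM (S '' p) (Cardinal.mk_image_le.trans_lt hp) (by
    rintro _ ⟨φ, _, rfl⟩
    refine definable₁_iff.2 ⟨φ.relabel (Sum.map (fun a => ⟨g a, trivial⟩) id), ?_⟩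
    ext x
    simp only [S, Set.mem_ofPred_eq, Formula.realize_relabel, Sum.elim_comp_map]
    rfl) (by
    intro G hG hfin
    obtain ⟨q, hq, hqfin, rfl⟩ :=
      (Set.exists_subset_image_finite_and (p := fun t => t = G)).1 ⟨G, hG, hfin, rfl⟩
    obtain ⟨c, hc⟩ := h hqfin.toFinset (by simpa using hq)
    refine ⟨c, ?_⟩
    rintro _ ⟨φ, hφ, rfl⟩
    exact hc φ (by simpa using hφ))
  exact ⟨c, fun φ hφ => hc _ ⟨φ, hφ, rfl⟩⟩

/-- Each definable set needs finitely many parameters, so fewer than κ of them need fewer than κ.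
Conversely, since |T| < κ, fewer than κ parameters give fewer than κ formulas. -/
theorem isKappaSaturated_iff_defCompact {κ : Cardinal.{u}} (hκ : theoryCard L < κ) :
    IsKappaSaturated L κ M ↔ DefCompact L κ M := by
  have h0 : ℵ₀ ≤ theoryCard L := le_max_left _ _
  have hc : ∀ c : Fin 1 → M, c = fun _ => c 0 := fun c =>
    funext fun i => by rw [Subsingleton.elim i 0]
  constructor
  · intro h F hF hD hG
    have key : ∀ D : F, ∃ (A : Finset M) (φ : L.Formula (A ⊕ Fin 1)),
        D.1 = {x | φ.Realize (Sum.elim (↑) fun _ => x)} := by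
      intro D
      obtain ⟨A, _, hA⟩ := Set.definable_iff_finitely_definable.1 (hD D D.2)
      exact ⟨A, definable₁_iff.1 hA⟩
    choose A φ hφ using key
    let B : Set M := ⋃ D, (A D : Set M)
    have hB : #B < κ := by
      refine (Cardinal.mk_iUnion_le _).trans_lt ?_
      refine (mul_le_mul_right (c := ℵ₀) (ciSup_le' fun D => ?_) _).trans_lt ?_
      · exact (Cardinal.lt_aleph0_of_finite _).le
      · exact (Cardinal.mul_le_max _ _).trans_lt
          (max_lt (max_lt hF (h0.trans_lt hκ)) (h0.trans_lt hκ))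
    let ψ : F → L.Formula (B ⊕ Fin 1) := fun D =>
      (φ D).relabel (Sum.map (fun a => ⟨a.1, Set.mem_iUnion.2 ⟨D, a.2⟩⟩) id)
    have hψ : ∀ D : F, D.1 = {x | (ψ D).Realize (Sum.elim (fun a : B => (a : M)) fun _ => x)} := by
      intro D
      rw [hφ]
      ext x
      simp only [ψ, Set.mem_ofPred_eq, Formula.realize_relabel, Sum.elim_comp_map]
      rfl
    obtain ⟨c, hc'⟩ := h B hB (Set.range ψ) (by
      classical
      intro q hq
      have : ∀ χ : q, ∃ D, ψ D = χ.1 := fun χ => hq χ.2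
      choose d hd using this
      obtain ⟨c, hc'⟩ := hG (Set.range fun ψ => (d ψ).1)
        (by rintro _ ⟨ψ, rfl⟩; exact (d ψ).2) (Set.finite_range _)
      refine ⟨fun _ => c, fun χ hχ => ?_⟩
      have h1 := hc' _ ⟨⟨χ, hχ⟩, rfl⟩
      have h2 := (Set.ext_iff.1 (hψ (d ⟨χ, hχ⟩)) c).1 h1
      rwa [hd] at h2)
    refine ⟨c 0, fun D hD => ?_⟩
    refine (Set.ext_iff.1 (hψ ⟨D, hD⟩) (c 0)).2 ?_
    have := hc' ⟨⟨D, hD⟩, rfl⟩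
    rw [hc c] at this
    exact this
  · intro h A hA p hp
    obtain ⟨c, hc'⟩ := h.exists_realize (fun a : A => (a : M)) p (by
      refine (Cardinal.mk_set_le p).trans_lt (mk_formula_sum_le.trans_lt (max_lt hκ hA))) (by
      intro q hq
      obtain ⟨c, hc'⟩ := hp q hq
      refine ⟨c 0, fun φ hφ => ?_⟩
      have := hc' hφ
      rw [hc c] at this
      exact this)
    exact ⟨fun _ => c, hc'⟩

end Compactness

/-! ### Cardinal estimates for the construction of compact models -/

/-- A set with fewer than κ elements is the range of a function on a proper initial segment of κ,
and there are at most κ · θ^{<κ} ≤ θ such functions. -/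
theorem mk_sets_lt_le {α : Type u} {κ θ : Cardinal.{u}} (hα : #α ≤ θ) (hκθ : κ ≤ θ)
    (hθ : ℵ₀ ≤ θ) (hpow : θ ^< κ ≤ θ) : #{t : Set α // #t < κ} ≤ θ := by
  obtain ⟨r, wo, hr⟩ := Cardinal.exists_ord_eq κ.out
  rw [Cardinal.mk_out] at hr
  have hseg : ∀ i : κ.out, #{j // r j i} < κ := by
    intro i
    have h := Ordinal.typein_lt_type r i
    rw [← hr, Cardinal.lt_ord] at h
    exact h
  have hsig : #(Σ i : κ.out, ({j // r j i} → α)) ≤ θ := by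
    rw [Cardinal.mk_sigma]
    refine (Cardinal.sum_le_sum _ (fun _ => θ) fun i => ?_).trans ?_
    · rw [← Cardinal.power_def]
      exact (Cardinal.power_le_power_right hα).trans
        ((Cardinal.le_powerlt _ (hseg i)).trans hpow)
    · rw [Cardinal.sum_const', Cardinal.mk_out]
      exact (mul_le_mul_left hκθ θ).trans (Cardinal.mul_eq_self hθ).le
  refine le_trans ?_ hsig
  have key : ∀ t : {t : Set α // #t < κ}, ∃ s : Σ i : κ.out, ({j // r j i} → α),
      Set.range s.2 = t.1 := by
    rintro ⟨t, ht⟩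
    obtain ⟨i, hi⟩ := Ordinal.typein_surj r (o := (#t).ord) (by
      rw [← hr]; exact Cardinal.ord_lt_ord.2 ht)
    have hc : #{j // r j i} = #t := by
      have h := congrArg Ordinal.card hi
      rw [Cardinal.card_ord] at h
      exact h
    obtain ⟨e⟩ := Cardinal.eq.1 hc
    refine ⟨⟨i, fun j => (e j : α)⟩, ?_⟩
    ext x
    constructor
    · rintro ⟨j, rfl⟩
      exact (e j).2
    · intro hx
      exact ⟨e.symm ⟨x, hx⟩, by simp⟩
  choose s hs using key
  refine Cardinal.mk_le_of_injective (f := s) fun t t' h => ?_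
  exact Subtype.ext (by rw [← hs t, ← hs t', h])

theorem mk_iUnion_lt_of {ι α : Type u} {κ θ : Cardinal.{u}} (hκθ : κ ≤ θ) (hθ : ℵ₀ ≤ θ)
    (hreg : κ < θ ∨ θ.IsRegular) (hι : #ι < θ) (f : ι → Set α) (hf : ∀ i, #(f i) < κ) :
    #(⋃ i, f i) < θ := by
  rcases hreg with h | h
  · refine (Cardinal.mk_iUnion_le_sum_mk).trans_lt ?_
    refine (Cardinal.sum_le_sum _ (fun _ => κ) fun i => (hf i).le).trans_lt ?_
    rw [Cardinal.sum_const']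
    exact Cardinal.mul_lt_of_lt hθ hι h
  · exact (Cardinal.card_iUnion_lt_iff_forall_of_isRegular h hι).2 fun i => (hf i).trans_le hκθ

/-! ### Existence of compact models -/

section Saturation

variable {L : FirstOrder.Language.{u, u}} {M : Type u} [L.Structure M]

/-- The assignment `v` preserves the type of `v₀`, and for every pair `(Q, y)` of `A` the value of
the variable `y` realizes the set of formulas `Q`. -/
def ModelsWitnesses {Y Z : Type u} {κ : Cardinal.{u}} (v₀ : Y → M)
    (A : Set ({Q : Set (L.Formula ((Y ⊕ Z) ⊕ Fin 1)) // #Q < κ} × Z)) {N : Type u} [L.Structure N]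
    (v : Y ⊕ Z → N) : Prop :=
  (∀ φ : L.Formula Y, φ.Realize v₀ → φ.Realize (v ∘ Sum.inl)) ∧
    ∀ p ∈ A, ∀ φ ∈ p.1.1, φ.Realize (Sum.elim v fun _ => v (Sum.inr p.2))

/-- Existence of a model which is compact for families of fewer than `κ` definable sets and
realizes a given type. -/
theorem exists_defCompact {Y : Type u} (v₀ : Y → M) [Nonempty M] {κ θ : Cardinal.{u}}
    (hY : #Y ≤ θ) (hL : theoryCard L ≤ θ) (hκ : ℵ₀ < κ) (hκθ : κ ≤ θ)
    (hreg : κ < θ ∨ θ.IsRegular) (hpow : θ ^< κ ≤ θ) :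
    ∃ (N : Type u) (_ : L.Structure N) (w : Y → N), #N ≤ θ ∧ DefCompact L κ N ∧
      ∀ φ : L.Formula Y, φ.Realize v₀ → φ.Realize w := by
  classical
  have hθ : ℵ₀ ≤ θ := hκ.le.trans hκθ
  let Z : Type u := θ.out
  have hZ : #Z = θ := Cardinal.mk_out θ
  have : Nonempty Z := Cardinal.mk_ne_zero_iff.1 (by
    rw [hZ]; exact (Cardinal.aleph0_pos.trans_le hθ).ne')
  let X := Y ⊕ Z
  have hX : #X ≤ θ := by
    rw [Cardinal.mk_sum, Cardinal.lift_id, Cardinal.lift_id, hZ]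
    exact (add_le_add_left hY θ).trans (Cardinal.add_eq_self hθ).le
  let ι := {Q : Set (L.Formula (X ⊕ Fin 1)) // #Q < κ}
  have hι : #ι ≤ θ := mk_sets_lt_le (mk_formula_sum_le.trans (max_le hL hX)) hκθ hθ hpow
  let Good : Set (ι × Z) → Prop := fun A =>
    ∃ (N : Type u) (_ : L.Structure N) (v : X → N), ModelsWitnesses v₀ A v
  -- A Henkin construction. A task Q is closed either by promising that a variable y realizes it, or
  -- because no model of the promises made so far realizes it. The second alternative persists,
  -- since further promises leave fewer models.
  let Done : ι → Set (ι × Z) → Prop := fun Q A =>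
    (∃ y, (Q, y) ∈ A) ∨ ∀ (N : Type u) (_ : L.Structure N) (v : X → N), ModelsWitnesses v₀ A v →
      ¬ ∃ b : N, ∀ φ ∈ Q.1, φ.Realize (Sum.elim v fun _ => b)
  have anti : ∀ {A B : Set (ι × Z)} {N : Type u} [L.Structure N] {v : X → N}, A ⊆ B →
      ModelsWitnesses v₀ B v → ModelsWitnesses v₀ A v :=
    fun h hv => ⟨hv.1, fun p hp => hv.2 p (h hp)⟩
  have hmain : ∃ A, Good A ∧ #A ≤ θ ∧ ∀ t, Done t A := by
    refine exists_good_all_done hι Good Done ?mono ?chain ?step ?h0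
    case mono =>
      rintro Q A B hAB (⟨y, hy⟩ | h)
      · exact Or.inl ⟨y, hAB hy⟩
      · exact Or.inr fun N _ v hv => h N _ v (anti hAB hv)
    case chain =>
      intro C hne hC hgood
      let Γ : Set (ι × Z) → Set (L.Formula X) := fun A =>
        (Formula.relabel Sum.inl) '' {φ : L.Formula Y | φ.Realize v₀} ∪
          {ψ | ∃ p ∈ A, ∃ φ ∈ p.1.1, ψ = φ.relabel (Sum.elim id fun _ => Sum.inr p.2)}
      have hΓ : ∀ (A : Set (ι × Z)) (N : Type u) (_ : L.Structure N) (v : X → N),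
          (∀ φ ∈ Γ A, φ.Realize v) ↔ ModelsWitnesses v₀ A v := by
        intro A N _ v
        have e : ∀ y : Z, v ∘ (Sum.elim id fun _ : Fin 1 => Sum.inr y) =
            Sum.elim v fun _ => v (Sum.inr y) := by
          intro y; funext i; rcases i with i | i <;> rfl
        constructor
        · intro h
          refine ⟨fun φ hφ => ?_, fun p hp φ hφ => ?_⟩
          · have := h _ (Or.inl ⟨φ, hφ, rfl⟩)
            rwa [Formula.realize_relabel] at this
          · have := h _ (Or.inr ⟨p, hp, φ, hφ, rfl⟩)
            rwa [Formula.realize_relabel, e] at this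
        · rintro ⟨h1, h2⟩ _ (⟨φ, hφ, rfl⟩ | ⟨p, hp, φ, hφ, rfl⟩)
          · rw [Formula.realize_relabel]
            exact h1 φ hφ
          · rw [Formula.realize_relabel, e]
            exact h2 p hp φ hφ
      obtain ⟨N, i, v, hv⟩ := exists_realize_of_finite (Γ (⋃₀ C)) (by
        intro F hF
        have : ∃ A ∈ C, (F : Set (L.Formula X)) ⊆ Γ A := by
          induction F using Finset.induction_on with
          | empty => exact ⟨_, hne.some_mem, by simp⟩
          | insert φ F _ ih =>
            rw [Finset.coe_insert, Set.insert_subset_iff] at hF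
            obtain ⟨A, hA, hFA⟩ := ih hF.2
            have : ∃ B ∈ C, φ ∈ Γ B := by
              rcases hF.1 with h | ⟨p, ⟨B, hB, hp⟩, h⟩
              · exact ⟨A, hA, Or.inl h⟩
              · exact ⟨B, hB, Or.inr ⟨p, hp, h⟩⟩
            obtain ⟨B, hB, hφ⟩ := this
            have mono : ∀ {A B : Set (ι × Z)}, A ⊆ B → Γ A ⊆ Γ B := fun h =>
              Set.union_subset_union_right _ fun ψ ⟨p, hp, hψ⟩ => ⟨p, h hp, hψ⟩
            rcases hC.total hA hB with h | h
            · refine ⟨B, hB, ?_⟩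
              rw [Finset.coe_insert, Set.insert_subset_iff]
              exact ⟨hφ, hFA.trans (mono h)⟩
            · refine ⟨A, hA, ?_⟩
              rw [Finset.coe_insert, Set.insert_subset_iff]
              exact ⟨mono h hφ, hFA⟩
        obtain ⟨A, hA, hFA⟩ := this
        obtain ⟨N, i, v, hv⟩ := hgood A hA
        exact ⟨N, i, v, fun φ hφ => (hΓ A N i v).2 hv φ (hFA hφ)⟩)
      exact ⟨N, i, v, (hΓ _ N i v).1 hv⟩
    case h0 =>
      refine ⟨M, inferInstance, Sum.elim v₀ fun _ => Classical.arbitrary M, fun φ hφ => ?_, by simp⟩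
      rwa [Sum.elim_comp_inl]
    case step =>
      intro A _ hcard Q
      by_cases hQ : ∃ (N : Type u) (_ : L.Structure N) (v : X → N), ModelsWitnesses v₀ A v ∧
          ∃ b : N, ∀ φ ∈ Q.1, φ.Realize (Sum.elim v fun _ => b)
      swap
      · exact Or.inl (Or.inr fun N i v hv hb => hQ ⟨N, i, v, hv, hb⟩)
      obtain ⟨N, i, v, hv, b, hb⟩ := hQ
      -- Fewer than θ promises have been made and each involves fewer than κ variables of Z, so a
      -- variable y is still fresh. Reassigning it to b disturbs no earlier promise.
      let vars : ι → Set Z := fun Q => ⋃ φ : Q.1, {y | Sum.inl (Sum.inr y) ∈ φ.1.freeVarFinset}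
      have hvars : ∀ Q, #(vars Q) < κ := by
        intro Q
        refine (Cardinal.mk_iUnion_le _).trans_lt ?_
        refine (mul_le_mul_right (c := ℵ₀) (ciSup_le' fun φ => ?_) _).trans_lt ?_
        · refine Set.Countable.le_aleph0 (Set.Finite.countable ?_)
          exact Set.Finite.preimage (f := fun y : Z => (Sum.inl (Sum.inr y) : X ⊕ Fin 1))
            (fun a _ b _ h => Sum.inr_injective (Sum.inl_injective h)) φ.1.freeVarFinset.finite_toSet
        · exact (Cardinal.mul_le_max _ _).trans_lt (max_lt (max_lt Q.2 hκ) hκ)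
      have hused : #(⋃ p : A, (vars p.1.1 ∪ {p.1.2}) : Set Z) < θ := by
        refine mk_iUnion_lt_of hκθ hθ hreg hcard _ fun p => ?_
        refine (Cardinal.mk_union_le _ _).trans_lt ?_
        refine Cardinal.add_lt_of_lt hκ.le (hvars _) ?_
        rw [Cardinal.mk_singleton]
        exact Cardinal.one_lt_aleph0.trans hκ
      have hused' : #(vars Q ∪ ⋃ p : A, (vars p.1.1 ∪ {p.1.2}) : Set Z) < θ :=
        (Cardinal.mk_union_le _ _).trans_lt
          (Cardinal.add_lt_of_lt hθ ((hvars Q).trans_le hκθ) hused)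
      obtain ⟨y, hy⟩ : ∃ y : Z, y ∉ (vars Q ∪ ⋃ p : A, (vars p.1.1 ∪ {p.1.2}) : Set Z) := by
        by_contra! h
        rw [Set.eq_univ_iff_forall.2 h, Cardinal.mk_univ, hZ] at hused'
        exact lt_irrefl _ hused'
      simp only [Set.mem_union, not_or, Set.mem_iUnion, not_exists, Set.mem_singleton_iff] at hy
      obtain ⟨hyQ, hyA⟩ := hy
      let v' : X → N := Function.update v (Sum.inr y) b
      have hcongr : ∀ (Q : ι) (c : N), y ∉ vars Q → ∀ φ ∈ Q.1,
          (φ.Realize (Sum.elim v fun _ => c) ↔ φ.Realize (Sum.elim v' fun _ => c)) := by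
        intro Q c hy φ hφ
        refine realize_congr_freeVar φ fun a ha => ?_
        rcases a with x | x
        · have hx : x ≠ Sum.inr y := by
            rintro rfl
            exact hy (Set.mem_iUnion.2 ⟨⟨φ, hφ⟩, ha⟩)
          simp [v', hx]
        · rfl
      refine Or.inr ⟨(Q, y), ⟨N, i, v', ?_, ?_⟩, Or.inl ⟨y, Set.mem_insert _ _⟩⟩
      · intro φ hφ
        have : v' ∘ Sum.inl = v ∘ Sum.inl := by funext x; simp [v']
        rw [this]
        exact hv.1 φ hφ
      · rintro p (rfl | hp) φ hφ
        · have : v' (Sum.inr y) = b := by simp [v']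
          simp only [this]
          exact (hcongr Q b hyQ φ hφ).1 (hb φ hφ)
        · have h := hyA ⟨p, hp⟩
          have : v' (Sum.inr p.2) = v (Sum.inr p.2) := by
            have : p.2 ≠ y := fun h' => h.2 h'.symm
            exact Function.update_of_ne (fun h' => this (Sum.inr_injective h')) _ _
          rw [this]
          exact (hcongr p.1 _ h.1 φ hφ).1 (hv.2 p hp φ hφ)
  obtain ⟨A, ⟨N, _, v, hv⟩, -, hA⟩ := hmain
  have hone : (1 : Cardinal) < κ := Cardinal.one_lt_aleph0.trans hκ
  let S : Set N := Set.range v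
  let sec : S → X := fun s => s.2.choose
  have hsec : ∀ s, v (sec s) = s := fun s => s.2.choose_spec
  have wit : ∀ Q : ι, (∃ (N' : Type u) (_ : L.Structure N') (v' : X → N'),
      ModelsWitnesses v₀ A v' ∧ ∃ b : N', ∀ φ ∈ Q.1, φ.Realize (Sum.elim v' fun _ => b)) →
      ∃ y : Z, ∀ φ ∈ Q.1, φ.Realize (Sum.elim v fun _ => v (Sum.inr y)) := by
    rintro Q ⟨N', i, v', hv', hb⟩
    rcases hA Q with ⟨y, hy⟩ | h
    · exact ⟨y, hv.2 _ hy⟩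
    · exact absurd hb (h N' i v' hv')
  have helim : ∀ b : N, Sum.elim v (fun _ : Fin 1 => b) ∘ Sum.map sec id =
      Sum.elim (fun s : S => (s : N)) fun _ => b := by
    intro b
    rw [Sum.elim_comp_map]
    congr 1
    funext s
    exact hsec s
  -- The Tarski–Vaught test, from the tasks consisting of one formula.
  have hS : L.MeetsDefinable S := by
    rintro D ⟨b, hb⟩ hD
    obtain ⟨φ, rfl⟩ := definable₁_iff.1 hD
    obtain ⟨y, hy⟩ := wit ⟨{φ.relabel (Sum.map sec id)}, by simpa using hone⟩
      ⟨N, inferInstance, v, hv, b, by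
        intro ψ hψ
        rw [Set.mem_singleton_iff.1 hψ, Formula.realize_relabel, helim]
        exact hb⟩
    refine ⟨v (Sum.inr y), ?_, ⟨_, rfl⟩⟩
    have := hy _ rfl
    rwa [Formula.realize_relabel, helim] at this
  let E := hS.toElementarySubstructure
  have hE : ∀ x, x ∈ E ↔ x ∈ S := fun x => by
    rw [← SetLike.mem_coe]
    exact Set.ext_iff.1 hS.closure_eq_self x
  have hvE : ∀ x, v x ∈ E := fun x => (hE _).2 ⟨x, rfl⟩
  refine ⟨E, inferInstance, fun y => ⟨v (Sum.inl y), hvE _⟩, ?_, ?_, ?_⟩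
  · refine (Cardinal.mk_le_of_surjective (f := fun x : X => (⟨v x, hvE x⟩ : E)) ?_).trans hX
    rintro ⟨x, hx⟩
    obtain ⟨y, rfl⟩ := (hE x).1 hx
    exact ⟨y, rfl⟩
  · refine defCompact_of_formulas fun p hp hfin => ?_
    have : Nonempty E := ⟨⟨_, hvE (Classical.arbitrary X)⟩⟩
    -- An elementary extension of E keeps all promises. A realization of p there rules out that its
    -- task was closed as unrealizable, so a witness variable was provided.
    obtain ⟨N', i, f, c, hc⟩ := exists_elementary_extension_realizing (n := 1) p (by
      intro q hq
      obtain ⟨c, hc⟩ := hfin q hq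
      exact ⟨_, hc⟩)
    let secE : E → X := fun e => sec ⟨e, (hE _).1 e.2⟩
    have hsecE : ∀ e, (⟨v (secE e), hvE _⟩ : E) = e := fun e => Subtype.ext (hsec _)
    let v' : X → N' := fun x => f ⟨v x, hvE x⟩
    have hreal : ∀ (α : Type u) (φ : L.Formula α) (a : α → E),
        φ.Realize (fun i => (a i : N)) ↔ φ.Realize (f ∘ a) := fun α φ a => by
      rw [f.map_formula]
      exact E.subtype.map_formula φ a
    have hreal' : ∀ (α : Type u) (φ : L.Formula (α ⊕ Fin 1)) (a : α → E) (b : E),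
        φ.Realize (Sum.elim (fun i => (a i : N)) fun _ => (b : N)) ↔
          φ.Realize (Sum.elim (f ∘ a) fun _ => f b) := fun α φ a b => by
      have h := hreal (α ⊕ Fin 1) φ (Sum.elim a fun _ => b)
      rw [Sum.comp_elim] at h
      rw [← Function.comp_def, Sum.comp_elim] at h
      exact h
    have hv' : ModelsWitnesses v₀ A v' :=
      ⟨fun φ hφ => (hreal Y φ fun y => ⟨v (Sum.inl y), hvE _⟩).1 (hv.1 φ hφ), fun p hp φ hφ =>
        (hreal' X φ (fun x => ⟨v x, hvE x⟩) ⟨_, hvE (Sum.inr p.2)⟩).1 (hv.2 p hp φ hφ)⟩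
    obtain ⟨y, hy⟩ := wit ⟨Formula.relabel (Sum.map secE id) '' p,
      Cardinal.mk_image_le.trans_lt hp⟩ ⟨N', i, v', hv', c 0, by
        rintro _ ⟨φ, hφ, rfl⟩
        rw [Formula.realize_relabel, Sum.elim_comp_map]
        have h := hc φ hφ
        have e1 : v' ∘ secE = f := funext fun e => congrArg f (hsecE e)
        have e2 : (fun _ : Fin 1 => c 0) ∘ id = c :=
          funext fun i => by rw [Subsingleton.elim i 0]; rfl
        rwa [e1, e2]⟩
    refine ⟨⟨_, hvE (Sum.inr y)⟩, fun φ hφ => ?_⟩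
    have h := hy _ ⟨φ, hφ, rfl⟩
    rw [Formula.realize_relabel, Sum.elim_comp_map] at h
    rw [← E.subtype.map_formula, Sum.comp_elim]
    convert h using 2
    · funext e
      exact (hsec ⟨e.1, (hE _).1 e.2⟩).symm
    · rfl
  · intro φ hφ
    rw [← E.subtype.map_formula]
    exact hv.1 φ hφ

end Saturation

/-! ### The P-part: relativization, induced structure and completeness -/

section PredicatePart

variable {L : FirstOrder.Language.{u, u}} {T : L.Theory} {P : L.Relations 1}

theorem realize_formula₁_iff {M : Type u} {α : Type*} [L.Structure M] (v : α → M) (a : α) :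
    (P.formula₁ (Term.var a)).Realize v ↔ v a ∈ predSet P M := by
  simp [predSet, Formula.realize_rel₁]

theorem map_mem_predSet_iff {M N : Type u} [L.Structure M] [L.Structure N] (f : M ↪ₑ[L] N)
    {x : M} : f x ∈ predSet P N ↔ x ∈ predSet P M := by
  have h := f.map_formula (P.formula₁ (Term.var (0 : Fin 1))) fun _ => x
  rwa [realize_formula₁_iff, realize_formula₁_iff] at h

/-- Relativization: formulas about the `P`-part are formulas about the whole structure. -/
theorem exists_relativization {M : Type u} [L.Structure M] {α : Type u} {n : ℕ}
    (φ : (relPart L).BoundedFormula α n) :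
    ∃ ψ : L.BoundedFormula α n, ∀ (v : α → predSet P M) (xs : Fin n → predSet P M),
      ψ.Realize (fun i => (v i : M)) (fun i => (xs i : M)) ↔ φ.Realize v xs := by
  have hterm : ∀ {β : Type u} (t : (relPart L).Term β), ∃ i, t = Term.var i := by
    rintro β (i | ⟨f, _⟩)
    · exact ⟨i, rfl⟩
    · exact f.elim
  have helim : ∀ {n : ℕ} (v : α → predSet P M) (xs : Fin n → predSet P M) (i : α ⊕ Fin n),
      Sum.elim (fun i => (v i : M)) (fun i => (xs i : M)) i = (Sum.elim v xs i : predSet P M) := by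
    rintro n v xs (i | i) <;> rfl
  induction φ with
  | falsum => exact ⟨⊥, fun v xs => Iff.rfl⟩
  | equal t₁ t₂ =>
    obtain ⟨i, rfl⟩ := hterm t₁
    obtain ⟨j, rfl⟩ := hterm t₂
    refine ⟨BoundedFormula.equal (Term.var i) (Term.var j), fun v xs => ?_⟩
    simp only [BoundedFormula.Realize, Term.realize_var, helim, Subtype.coe_inj]
  | rel R ts =>
    choose i hi using fun j => hterm (ts j)
    refine ⟨BoundedFormula.rel (L := L) R fun j => Term.var (i j), fun v xs => ?_⟩
    simp only [BoundedFormula.Realize, Term.realize_var, helim, hi]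
    rfl
  | imp φ₁ φ₂ ih₁ ih₂ =>
    obtain ⟨ψ₁, h₁⟩ := ih₁
    obtain ⟨ψ₂, h₂⟩ := ih₂
    refine ⟨ψ₁.imp ψ₂, fun v xs => ?_⟩
    simp only [BoundedFormula.realize_imp, h₁, h₂]
  | @all n φ ih =>
    obtain ⟨ψ, h⟩ := ih
    refine ⟨((P.boundedFormula₁ (Term.var (Sum.inr (Fin.last n)))).imp ψ).all, fun v xs => ?_⟩
    simp only [BoundedFormula.realize_all, BoundedFormula.realize_imp,
      BoundedFormula.realize_rel₁, Term.realize_var, Sum.elim_inr, Fin.snoc_last]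
    have hs : ∀ x : predSet P M, (Fin.snoc (fun i => (xs i : M)) (x : M) : Fin (n + 1) → M) =
        fun i => ((Fin.snoc xs x : Fin (n + 1) → predSet P M) i : M) := fun x =>
      (Fin.comp_snoc (fun y : predSet P M => (y : M)) xs x).symm
    constructor
    · intro H x
      have := H x x.2
      rwa [hs, h] at this
    · intro H x hx
      have := H ⟨x, hx⟩
      rwa [← h, ← hs] at this

/-- If all definable families in `M` are `κ`-compact then so are those of its `P`-part. -/
theorem DefCompact.predSet {M : Type u} [L.Structure M] {κ : Cardinal.{u}} (hκ : ℵ₀ ≤ κ)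
    (hM : DefCompact L κ M) (hne : (predSet P M).Nonempty) :
    DefCompact (relPart L) κ (predSet P M) := by
  intro F hF hD hG
  let im : Set (OverPredicate.predSet P M) → Set M := fun D => (↑) '' D
  have him : Function.Injective im := Set.image_injective.2 Subtype.val_injective
  -- The predicate itself joins the family, to force the common point into P.
  obtain ⟨x, hx⟩ := hM (insert (OverPredicate.predSet P M) (im '' F)) (by
      refine (Cardinal.mk_insert_le).trans_lt ?_
      exact Cardinal.add_lt_of_lt hκ (Cardinal.mk_image_le.trans_lt hF)
        (Cardinal.one_lt_aleph0.trans_le hκ)) (by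
    rintro _ (rfl | ⟨D, hDF, rfl⟩)
    · exact definable₁_predSet P
    · obtain ⟨φ, hφ⟩ := definable₁_iff.1 (hD D hDF)
      obtain ⟨ψ, hψ⟩ := exists_relativization (P := P) (M := M) φ
      have h1 : (Set.univ : Set M).Definable₁ L {x : M | Formula.Realize ψ
          (Sum.elim (fun i : (Set.univ : Set (OverPredicate.predSet P M)) => (i.1 : M))
            fun _ => x)} := by
        refine definable₁_iff.2 ⟨Formula.relabel (Sum.map (fun i => ⟨i.1.1, trivial⟩) id) ψ, ?_⟩
        ext x
        simp only [Set.mem_ofPred_eq, Formula.realize_relabel, Sum.elim_comp_map]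
        rfl
      convert definable₁_inter h1 (definable₁_predSet P) using 1
      ext x
      have key : ∀ x : OverPredicate.predSet P M, x ∈ D ↔ Formula.Realize ψ
          (Sum.elim (fun i : (Set.univ : Set (OverPredicate.predSet P M)) => (i.1 : M))
            fun _ => (x : M)) := by
        intro x
        have h := hψ (Sum.elim (↑) fun _ => x) default
        rw [hφ]
        refine h.symm.trans ?_
        have e : (fun i => ((Sum.elim (fun i : (Set.univ : Set (OverPredicate.predSet P M)) => i.1)
            (fun _ : Fin 1 => x) i : OverPredicate.predSet P M) : M)) =
            Sum.elim (fun i => (i.1 : M)) fun _ => (x : M) := by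
          funext i; rcases i with i | i <;> rfl
        rw [e, Formula.Realize]
        exact iff_of_eq (congrArg _ (Subsingleton.elim _ _))
      constructor
      · rintro ⟨y, hy, rfl⟩
        exact ⟨(key y).1 hy, y.2⟩
      · rintro ⟨hx, hxP⟩
        exact ⟨⟨x, hxP⟩, (key ⟨x, hxP⟩).2 hx, rfl⟩) (by
    intro G hG' hfin
    have hfin' : (F ∩ im ⁻¹' G).Finite := (hfin.preimage him.injOn).subset Set.inter_subset_right
    rcases (F ∩ im ⁻¹' G).eq_empty_or_nonempty with he | hne'
    · obtain ⟨x, hx⟩ := hne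
      refine ⟨x, fun D hDG => ?_⟩
      rcases hG' hDG with rfl | ⟨D, hDF, rfl⟩
      · exact hx
      · have : D ∈ F ∩ im ⁻¹' G := ⟨hDF, hDG⟩
        rw [he] at this
        exact this.elim
    · obtain ⟨x, hx⟩ := hG _ Set.inter_subset_left hfin'
      refine ⟨x, fun D hDG => ?_⟩
      rcases hG' hDG with rfl | ⟨D, hDF, rfl⟩
      · exact x.2
      · exact ⟨x, hx D ⟨hDF, hDG⟩, rfl⟩)
  refine ⟨⟨x, hx _ (Set.mem_insert _ _)⟩, fun D hDF => ?_⟩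
  obtain ⟨y, hy, rfl⟩ := hx _ (Or.inr ⟨D, hDF, rfl⟩)
  exact hy

theorem DefCompact.indexed {M ι : Type u} [L.Structure M] {κ : Cardinal.{u}}
    (hM : DefCompact L κ M) (hι : #ι < κ) (D : ι → Set M)
    (hD : ∀ i, (Set.univ : Set M).Definable₁ L (D i))
    (hfin : ∀ s : Finset ι, ∃ x, ∀ i ∈ s, x ∈ D i) : ∃ x, ∀ i, x ∈ D i := by
  classical
  obtain ⟨x, hx⟩ := hM (Set.range D) (Cardinal.mk_range_le.trans_lt hι)
    (by rintro _ ⟨i, rfl⟩; exact hD i) (by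
    intro G hG hf
    have := hf.fintype
    choose d hd using fun E : G => hG E.2
    obtain ⟨x, hx⟩ := hfin (Finset.univ.image d)
    refine ⟨x, fun E hE => ?_⟩
    have h := hx _ (Finset.mem_image_of_mem d (Finset.mem_univ ⟨E, hE⟩))
    rwa [hd] at h)
  exact ⟨x, fun i => hx _ ⟨i, rfl⟩⟩

/-- Fewer than κ points of an infinite definable set can all be avoided at once inside it. -/
theorem DefCompact.le_mk {M : Type u} [L.Structure M] {κ : Cardinal.{u}} (hκ : ℵ₀ ≤ κ)
    (hM : DefCompact L κ M) {D : Set M} (hD : (Set.univ : Set M).Definable₁ L D)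
    (hinf : D.Infinite) : κ ≤ #D := by
  classical
  by_contra! h
  obtain ⟨x, hx⟩ := hM.indexed (ι := Option D)
    (by
      rw [Cardinal.mk_option]
      exact Cardinal.add_lt_of_lt hκ h (Cardinal.one_lt_aleph0.trans_le hκ))
    (fun o => o.elim D fun a => {a.1}ᶜ) (by
      rintro (_ | a)
      · exact hD
      · exact definable₁_compl (Set.Definable.singleton_of_mem L trivial)) (by
      intro s
      obtain ⟨x, hxD, hx⟩ := hinf.exists_notMem_finset
        ((s.preimage some (Option.some_injective _).injOn).image Subtype.val)
      refine ⟨x, ?_⟩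
      rintro (_ | a) ha
      · exact hxD
      · simp only [Option.elim_some, Set.mem_compl_iff, Set.mem_singleton_iff]
        rintro rfl
        exact hx (by simpa using ha))
  have h1 : x ∈ D := hx none
  exact hx (some ⟨x, h1⟩) rfl

/-- Definable subsets of the predicate are definable in the `P`-part. -/
theorem definable₁_relPart (hT : StandingAssumptions T P) (M : Theory.ModelType.{u, u, u} T)
    {D : Set M} (hD : (Set.univ : Set M).Definable₁ L D) :
    (Set.univ : Set (predSet P M)).Definable₁ (relPart L) {x | (x : M) ∈ D} := by
  classical
  have h1 := hT.stably_embedded M 1 {v | v 0 ∈ D ∩ predSet P M}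
    (fun v hv i => by rw [Subsingleton.elim i 0]; exact hv.2)
    (definable₁_inter hD (definable₁_predSet P))
  obtain ⟨A, hA, hDA⟩ := Set.definable_iff_finitely_definable.1 h1
  obtain ⟨φ, hφ⟩ := definable₁_iff.1 hDA
  -- The parameters, moved into P by stable embeddedness, are turned into variables because
  -- `induced` concerns sets definable without parameters. They are substituted back in `h3`.
  let e : (A ⊕ Fin 1 : Type u) ≃ Fin (Fintype.card (A ⊕ Fin 1 : Type u)) := Fintype.equivFin _
  have h2 := hT.induced M _ {v | φ.Realize (v ∘ e) ∧ ∀ i, v i ∈ predSet P M}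
    (fun v hv => hv.2) (by
      refine Set.empty_definable_iff.2
        ⟨φ.relabel e ⊓ Formula.iInf fun i => P.formula₁ (Term.var i), ?_⟩
      ext v
      simp only [Set.mem_ofPred_eq, Formula.realize_inf, Formula.realize_relabel,
        Formula.realize_iInf]
      refine and_congr_right fun _ => forall_congr' fun i => ?_
      simp [predSet, Formula.realize_rel₁])
  obtain ⟨χ, hχ⟩ := Set.empty_definable_iff.1 h2
  have h3 := definable_of_formula (A := (Set.univ : Set (predSet P M))) (χ.relabel e.symm)
    (fun a => ⟨a, hA a.2⟩) (fun _ => trivial)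
  rw [Set.Definable₁]
  convert h3 using 1
  ext v
  simp only [Set.mem_ofPred_eq, Formula.realize_relabel]
  have h4 := Set.ext_iff.1 hχ
    (Sum.elim (fun a : A => (⟨a, hA a.2⟩ : predSet P M)) v ∘ e.symm)
  refine Iff.trans ?_ h4
  have h5 := Set.ext_iff.1 hφ (v 0)
  have e1 : (fun i => ((Sum.elim (fun a : A => (⟨a, hA a.2⟩ : predSet P M)) v ∘ e.symm) i : M)) ∘ e
      = Sum.elim (fun a : A => (a : M)) fun _ => (v 0 : M) := by
    funext i
    rcases i with i | i
    · simp
    · rw [Subsingleton.elim i 0]; simp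
  simp only [Set.mem_ofPred_eq]
  rw [e1]
  constructor
  · intro h
    exact ⟨h5.1 ⟨h, (v 0).2⟩, fun i => Subtype.coe_prop _⟩
  · intro h
    exact (h5.2 h.1).1

/-- Compactness for definable subsets of the predicate. -/
theorem exists_mem_predSet (hT : StandingAssumptions T P) (M : Theory.ModelType.{u, u, u} T)
    {κ : Cardinal.{u}} (hM : DefCompact (relPart L) κ (predSet P M)) {ι : Type u} (hι : #ι < κ)
    (D : ι → Set M) (hD : ∀ i, (Set.univ : Set M).Definable₁ L (D i))
    (hfin : ∀ s : Finset ι, ∃ x ∈ predSet P M, ∀ i ∈ s, x ∈ D i) :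
    ∃ x ∈ predSet P M, ∀ i, x ∈ D i := by
  obtain ⟨x, hx⟩ := hM.indexed hι _ (fun i => definable₁_relPart hT M (hD i)) (fun s => by
    obtain ⟨x, hxP, hx⟩ := hfin s
    exact ⟨⟨x, hxP⟩, hx⟩)
  exact ⟨x, x.2, hx⟩

variable {N : Type u} [L.Structure N]

/-- Every `A`-definable set that meets the predicate meets `B`. -/
def PMeets (P : L.Relations 1) (A B : Set N) : Prop :=
  ∀ D : Set N, A.Definable₁ L D → (D ∩ predSet P N).Nonempty → (D ∩ B).Nonempty

theorem PMeets.subset {A B : Set N} (h : PMeets P A B) : predSet P N ∩ A ⊆ B := by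
  rintro x ⟨hxP, hxA⟩
  obtain ⟨y, rfl, hy⟩ := h {x} (Set.Definable.singleton_of_mem L hxA) ⟨x, rfl, hxP⟩
  exact hy

/-- Coordinates are found one at a time: the first in a projection, and since B ⊆ A it may then
serve as a parameter for the rest. -/
theorem PMeets.tuple {A B : Set N} (h : PMeets P A B) (hBA : B ⊆ A) {k : ℕ}
    {W : Set (Fin k → N)} (hW : A.Definable L W) (hne : ∃ w ∈ W, ∀ i, w i ∈ predSet P N) :
    ∃ w ∈ W, ∀ i, w i ∈ B := by
  induction k with
  | zero =>
    obtain ⟨w, hw, _⟩ := hne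
    exact ⟨w, hw, fun i => i.elim0⟩
  | succ k ih =>
    have hdef : A.Definable₁ L
        {z | ∃ u : Fin k → N, Fin.cons z u ∈ W ∧ ∀ i, u i ∈ predSet P N} := by
      have h1 : A.Definable L {v : Fin 1 ⊕ Fin k → N |
          (v ∘ (Fin.cons (Sum.inl 0) Sum.inr : Fin (k + 1) → Fin 1 ⊕ Fin k)) ∈ W} :=
        hW.preimage_comp _
      have h2 : A.Definable L (⋂ i : Fin k, {v : Fin 1 ⊕ Fin k → N |
          v (Sum.inr i) ∈ predSet P N}) := by
        refine Set.definable_iInter_of_finite fun i => ?_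
        exact (definable₁_predSet P).preimage_comp
          (fun _ : Fin 1 => (Sum.inr i : Fin 1 ⊕ Fin k))
      have h3 := (h1.inter h2).exists_of_finite
      rw [Set.Definable₁]
      convert h3 using 1
      ext v
      refine exists_congr fun u => and_congr ?_ ?_
      · refine iff_of_eq (congrArg (· ∈ W) ?_)
        funext i
        refine Fin.cases ?_ (fun j => ?_) i <;> rfl
      · simp
    obtain ⟨w, hw, hwP⟩ := hne
    obtain ⟨b, ⟨u, hu, huP⟩, hb⟩ := h _ hdef ⟨w 0, ⟨Fin.tail w, by rwa [Fin.cons_self_tail],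
      fun i => hwP _⟩, hwP 0⟩
    have hWb : A.Definable L {u : Fin k → N | (Fin.cons b u : Fin (k + 1) → N) ∈ W} := by
      obtain ⟨φ, rfl⟩ := Set.definable_iff_exists_formula_sum.1 hW
      refine Set.definable_iff_exists_formula_sum.2
        ⟨φ.relabel (Sum.elim Sum.inl (Fin.cons (Sum.inl ⟨b, hBA hb⟩) Sum.inr)), ?_⟩
      ext u
      simp only [Set.mem_ofPred_eq, Formula.realize_relabel]
      refine iff_of_eq (congrArg _ ?_)
      funext i
      rcases i with i | i
      · rfl
      · refine Fin.cases ?_ (fun j => ?_) i <;> rfl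
    obtain ⟨u', hu', hB⟩ := ih hWb ⟨u, hu, huP⟩
    exact ⟨Fin.cons b u', hu', fun i => Fin.cases hb hB i⟩

/-- A definition uses finitely many parameters, and these already lie in one member of the chain. -/
theorem exists_definable_of_sUnion {C : Set (Set N)} (hne : C.Nonempty)
    (hC : IsChain (· ⊆ ·) C) {α : Type*} {D : Set (α → N)} (hD : (⋃₀ C).Definable L D) :
    ∃ A ∈ C, A.Definable L D := by
  obtain ⟨A₀, hA₀, h⟩ := Set.definable_iff_finitely_definable.1 hD
  rw [Set.sUnion_eq_biUnion] at hA₀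
  obtain ⟨A, hA, hsub⟩ := hC.directedOn.exists_mem_subset_of_finset_subset_biUnion hne hA₀
  exact ⟨A, hA, h.mono hsub⟩

theorem PMeets.sUnion {C : Set (Set N)} {B : Set N} (hne : C.Nonempty)
    (hC : IsChain (· ⊆ ·) C) (h : ∀ A ∈ C, PMeets P A B) : PMeets P (⋃₀ C) B := by
  intro D hD
  obtain ⟨A, hA, hDA⟩ := exists_definable_of_sUnion hne hC hD
  exact h A hA D hDA

/-- Families of fewer than `κ` sets definable over `A`, finite subfamilies of which have common
points in the predicate, have a common point in `B`. -/
def PCompact (P : L.Relations 1) (κ : Cardinal.{u}) (A B : Set N) : Prop :=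
  ∀ ⦃ι : Type u⦄ (D : ι → Set N), #ι < κ → (∀ i, A.Definable₁ L (D i)) →
    (∀ s : Finset ι, ∃ d ∈ predSet P N, ∀ i ∈ s, d ∈ D i) → ∃ d ∈ B, ∀ i, d ∈ D i

end PredicatePart

/-! ### Extending a family of conditions so that P does not grow -/

section Extension

variable {L : FirstOrder.Language.{u, u}} {T : L.Theory} {P : L.Relations 1}

theorem pCompact_univ (hT : StandingAssumptions T P) (M : Theory.ModelType.{u, u, u} T)
    {κ : Cardinal.{u}} (hM : DefCompact (relPart L) κ (predSet P M)) :
    PCompact P κ (Set.univ : Set M) (predSet P M) :=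
  fun _ D hι hD hfin => exists_mem_predSet hT M hM hι D hD hfin

theorem nonempty_predSet (hT : StandingAssumptions T P) (M : Theory.ModelType.{u, u, u} T) :
    (predSet P M).Nonempty :=
  (hT.infinite M).nonempty

/-- Over a set whose definable sets meet `P` inside `B`, definable subsets of `P` are definable
over `B`. -/
theorem PMeets.exists_definable (hT : StandingAssumptions T P) (N : Theory.ModelType.{u, u, u} T)
    {A B : Set N} (h : PMeets P A B) (hBA : B ⊆ A) {D : Set N} (hD : A.Definable₁ L D) :
    ∃ D' : Set N, B.Definable₁ L D' ∧ ∀ x ∈ predSet P N, x ∈ D ↔ x ∈ D' := by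
  classical
  have h1 := hT.stably_embedded N 1 {v | v 0 ∈ D ∩ predSet P N}
    (fun v hv i => by rw [Subsingleton.elim i 0]; exact hv.2)
    (definable₁_inter (hD.mono (Set.subset_univ _)) (definable₁_predSet P))
  obtain ⟨C, hC, hDC⟩ := Set.definable_iff_finitely_definable.1 h1
  obtain ⟨φ, hφ⟩ := definable₁_iff.1 hDC
  let e : C ≃ Fin (Fintype.card C) := Fintype.equivFin _
  -- The tuples w for which φ(w, ·) agrees with D on P form an A-definable set, and stable
  -- embeddedness gives one in P. Hence there is one in B.
  have hW : A.Definable L {w : Fin (Fintype.card C) → N |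
      ∀ z ∈ predSet P N, z ∈ D ↔ φ.Realize (Sum.elim (w ∘ e) fun _ => z)} := by
    have hz : ∀ {E : Set N}, A.Definable₁ L E → A.Definable L
        {v : Fin (Fintype.card C) ⊕ Fin 1 → N | v (Sum.inr 0) ∈ E} := fun hE =>
      hE.preimage_comp (fun _ : Fin 1 => (Sum.inr 0 : Fin (Fintype.card C) ⊕ Fin 1))
    have hf : A.Definable L {v : Fin (Fintype.card C) ⊕ Fin 1 → N |
        (φ.relabel (Sum.map e id)).Realize v} := by
      refine Set.definable_iff_exists_formula_sum.2
        ⟨(φ.relabel (Sum.map e id)).relabel Sum.inr, ?_⟩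
      ext v
      simp only [Set.mem_ofPred_eq, Formula.realize_relabel]
      rfl
    have h2 := (((hz (definable₁_predSet P)).compl.union
      (((hz hD).inter hf).union ((hz hD).compl.inter hf.compl)))).forall_of_finite
    convert h2 using 1
    ext w
    have hw : ∀ u : Fin 1 → N, (φ.relabel (Sum.map e id)).Realize (Sum.elim w u) ↔
        φ.Realize (Sum.elim (w ∘ e) fun _ => u 0) := fun u => by
      rw [Formula.realize_relabel, Sum.elim_comp_map]
      have : u ∘ id = fun _ => u 0 := funext fun i => by rw [Subsingleton.elim i 0]; rfl
      rw [this]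
    simp only [Set.mem_ofPred_eq, Set.mem_union, Set.mem_inter_iff, Set.mem_compl_iff, hw,
      Sum.elim_inr]
    constructor
    · intro H u
      have := H (u 0)
      tauto
    · intro H z hz
      have := H fun _ => z
      tauto
  obtain ⟨w, hw, hwB⟩ := h.tuple hBA hW ⟨fun i => (e.symm i : N), by
    intro z hz
    have := Set.ext_iff.1 hφ z
    have e1 : (fun i => (e.symm i : N)) ∘ e = fun c : C => (c : N) := funext fun c => by simp
    rw [e1]
    refine Iff.trans ?_ this
    simp [hz], fun i => hC (e.symm i).2⟩
  refine ⟨{z | φ.Realize (Sum.elim (w ∘ e) fun _ => z)},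
    definable₁_iff.2 ⟨φ.relabel (Sum.map (fun c => ⟨w (e c), hwB _⟩) id), ?_⟩, hw⟩
  ext z
  simp only [Set.mem_ofPred_eq, Formula.realize_relabel, Sum.elim_comp_map]
  rfl

/-- The traces on P of A-definable sets are traces of B-definable ones. Since B is the P-part of S,
their common point is found by compactness of that part. -/
theorem pCompact_of_elementarySubstructure (hT : StandingAssumptions T P)
    (N : Theory.ModelType.{u, u, u} T) (S : L.ElementarySubstructure N) {κ : Cardinal.{u}}
    (hS : DefCompact (relPart L) κ (predSet P S)) {A B : Set N} (h : PMeets P A B) (hBA : B ⊆ A)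
    (hBS : B ⊆ S) (hBP : B ⊆ predSet P N) (hSB : predSet P N ∩ S ⊆ B) : PCompact P κ A B := by
  intro ι D hι hD hfin
  choose D' hD' hDD' using fun i => h.exists_definable hT N hBA (hD i)
  have hpred : ∀ x : S, x ∈ predSet P S ↔ (x : N) ∈ predSet P N := by
    exact fun x => (map_mem_predSet_iff S.subtype).symm
  obtain ⟨(x : S), hxP, hx⟩ := exists_mem_predSet hT (S.toModel T) (κ := κ) hS hι
    (fun i => {x : S | (x : N) ∈ D' i}) (by
      intro i
      obtain ⟨φ, hφ⟩ := definable₁_iff.1 (hD' i)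
      refine definable₁_iff.2 ⟨φ.relabel (Sum.map (fun b : B => ⟨⟨b.1, hBS b.2⟩, trivial⟩) id), ?_⟩
      ext x
      simp only [Set.mem_ofPred_eq, Formula.realize_relabel, Sum.elim_comp_map]
      rw [hφ]
      refine Iff.trans ?_ (S.subtype.map_formula φ _)
      refine iff_of_eq (congrArg φ.Realize ?_)
      funext i
      rcases i with i | i <;> rfl) (by
      intro s
      obtain ⟨d, hdP, hd⟩ := hfin s
      obtain ⟨b, hb, hbB⟩ := h (⋂₀ (s.image D : Finset (Set N))) (definable₁_sInter
        (Finset.finite_toSet _) (by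
          intro E hE
          obtain ⟨i, _, rfl⟩ := Finset.mem_image.1 hE
          exact hD i)) ⟨d, by
            intro E hE
            obtain ⟨i, hi, rfl⟩ := Finset.mem_image.1 hE
            exact hd i hi, hdP⟩
      refine ⟨⟨b, hBS hbB⟩, (hpred _).2 (hBP hbB), fun i hi => ?_⟩
      exact (hDD' i b (hBP hbB)).1 (hb _ (Finset.mem_image_of_mem _ hi)))
  have hxP' : (x : N) ∈ predSet P N := (hpred x).1 hxP
  exact ⟨x, hSB ⟨hxP', x.2⟩, fun i => (hDD' i x hxP').2 (hx i)⟩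

variable {N : Type u} [L.Structure N]

/-- The finite intersection property. -/
def FIP (F : Set (Set N)) : Prop := ∀ G ⊆ F, G.Finite → (⋂₀ G).Nonempty

/-- The family `q` of sets decides, for every `A`-definable relation `E`, whether there is a
`z` in the predicate with `E z x`, and if so provides such a `z` in `B`. -/
def Decides (P : L.Relations 1) (A B : Set N) (q : Set (Set N)) : Prop :=
  ∀ E : Set (N × N), A.Definable₂ L E →
    {x | ¬ ∃ z ∈ predSet P N, (z, x) ∈ E} ∈ q ∨ ∃ d ∈ B, {x | (d, x) ∈ E} ∈ q

/-- There are at most κ relations E to decide, handled one at a time while fewer than κ sets have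
been added. If "no z in P satisfies E(z, x)" is inconsistent with the present family, compactness
yields a single d in B such that E(d, x) is consistent with all of it. -/
theorem PCompact.exists_decides {κ : Cardinal.{u}} {A B : Set N} (h : PCompact P κ A B)
    (hBA : B ⊆ A) (hκ : ℵ₀ < κ) (hL : theoryCard L ≤ κ) (hA : #A ≤ κ) (p : Set (Set N))
    (hp : #p < κ) (hpA : ∀ D ∈ p, A.Definable₁ L D) (hpF : FIP p) :
    ∃ q, p ⊆ q ∧ (∀ D ∈ q, A.Definable₁ L D) ∧ FIP q ∧ Decides P A B q := by
  classical
  have hDE : ∀ E, A.Definable₂ L E → A.Definable₁ L {x | ∃ z ∈ predSet P N, (z, x) ∈ E} :=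
    fun E hE => definable₁_exists (definable₂_swap hE) (definable₁_predSet P)
  have hmain := exists_good_all_done (α := Set N)
    (ι := {E : Set (N × N) | A.Definable₂ L E}) (κ := κ) (mk_definable₂_le.trans (max_le hL hA))
    (fun X => (∀ D ∈ X, A.Definable₁ L D) ∧ FIP (p ∪ X))
    (fun E X => {x | ¬ ∃ z ∈ predSet P N, (z, x) ∈ E.1} ∈ X ∨ ∃ d ∈ B, {x | (d, x) ∈ E.1} ∈ X)
    (by
      rintro E X Y hXY (h | ⟨d, hd, h⟩)
      · exact Or.inl (hXY h)
      · exact Or.inr ⟨d, hd, hXY h⟩) ?_ ?_ ?_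
  · obtain ⟨X, ⟨hX, hF⟩, -, hdec⟩ := hmain
    refine ⟨p ∪ X, Set.subset_union_left, ?_, hF, fun E hE => ?_⟩
    · rintro D (hD | hD)
      · exact hpA D hD
      · exact hX D hD
    · rcases hdec ⟨E, hE⟩ with h | ⟨d, hd, h⟩
      · exact Or.inl (Or.inr h)
      · exact Or.inr ⟨d, hd, Or.inr h⟩
  · intro C hne hC hgood
    refine ⟨fun D ⟨X, hX, hD⟩ => (hgood X hX).1 D hD, fun G hG hfin => ?_⟩
    have hC' : IsChain (· ⊆ ·) ((fun X => p ∪ X) '' C) := by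
      rintro _ ⟨X, hX, rfl⟩ _ ⟨Y, hY, rfl⟩ _
      rcases hC.total hX hY with h | h
      · exact Or.inl (Set.union_subset_union_right _ h)
      · exact Or.inr (Set.union_subset_union_right _ h)
    obtain ⟨_, ⟨X, hX, rfl⟩, hGX⟩ := hC'.directedOn.exists_mem_subset_of_finset_subset_biUnion
      (f := id) (s := hfin.toFinset) (hne.image _) (by
        intro D hD
        have hD : D ∈ G := by simpa using hD
        rcases hG hD with h | ⟨X, hX, h⟩
        · exact Set.mem_biUnion ⟨hne.some, hne.some_mem, rfl⟩ (Or.inl h)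
        · exact Set.mem_biUnion ⟨X, hX, rfl⟩ (Or.inr h))
    exact (hgood X hX).2 G (by simpa using hGX) hfin
  · rintro X ⟨hX, hF⟩ hcard ⟨E, hE⟩
    right
    have hpX : ∀ D ∈ p ∪ X, A.Definable₁ L D := by
      rintro D (hD | hD)
      · exact hpA D hD
      · exact hX D hD
    have hins : ∀ D, p ∪ insert D X = insert D (p ∪ X) := fun D => Set.union_insert
    by_cases hc : FIP (insert {x | ¬ ∃ z ∈ predSet P N, (z, x) ∈ E} (p ∪ X))
    · refine ⟨{x | ¬ ∃ z ∈ predSet P N, (z, x) ∈ E}, ⟨?_, by rwa [hins]⟩,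
        Or.inl (Set.mem_insert _ _)⟩
      rintro D (rfl | hD)
      · exact definable₁_compl (hDE E hE)
      · exact hX D hD
    · simp only [FIP, not_forall] at hc
      obtain ⟨G, hG, hGfin, hGe⟩ := hc
      -- A finite part of the family that already implies the existence of a z in P with E(z, x).
      let G₀ : Set (Set N) := G \ {{x | ¬ ∃ z ∈ predSet P N, (z, x) ∈ E}}
      have hG₀ : G₀ ⊆ p ∪ X := fun D hD => (hG hD.1).resolve_left hD.2
      have hcond : ∀ x ∈ ⋂₀ G₀, ∃ z ∈ predSet P N, (z, x) ∈ E := by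
        intro x hx
        by_contra hx'
        refine hGe ⟨x, fun D hD => ?_⟩
        by_cases hDE : D = {x | ¬ ∃ z ∈ predSet P N, (z, x) ∈ E}
        · rw [hDE]; exact hx'
        · exact hx D ⟨hD, hDE⟩
      have hcardF : #(Finset ↥(p ∪ X)) < κ := by
        have hu : #↥(p ∪ X) < κ :=
          (Cardinal.mk_union_le _ _).trans_lt (Cardinal.add_lt_of_lt hκ.le hp hcard)
        cases finite_or_infinite ↥(p ∪ X)
        · exact (Cardinal.lt_aleph0_of_finite _).trans hκ
        · rwa [Cardinal.mk_finset_of_infinite]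
      have hsub : ∀ s : Finset ↥(p ∪ X), ((↑) '' (s : Set ↥(p ∪ X)) : Set (Set N)) ⊆ p ∪ X := by
        rintro s _ ⟨D, _, rfl⟩
        exact D.2
      -- For each finite part s of the family, the condition on z is that E(z, x) has a solution x
      -- in every set of s. There are fewer than κ such conditions, and finitely many are met
      -- together in P by taking x in the union of those parts and in `G₀`.
      obtain ⟨d, hdB, hd⟩ := h (fun s : Finset ↥(p ∪ X) =>
          {z | ∃ x ∈ ⋂₀ ((↑) '' (s : Set ↥(p ∪ X)) : Set (Set N)), (z, x) ∈ E}) hcardF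
        (fun s => definable₁_exists hE (definable₁_sInter (s.finite_toSet.image _)
          fun D hD => hpX D (hsub s hD))) (by
        intro t
        obtain ⟨x, hx⟩ := hF (((↑) '' (t.biUnion id : Set ↥(p ∪ X)) : Set (Set N)) ∪ G₀)
          (Set.union_subset (hsub _) hG₀)
          (((t.biUnion id).finite_toSet.image _).union (hGfin.subset Set.sdiff_subset))
        obtain ⟨z, hz, hzE⟩ := hcond x fun D hD => hx D (Or.inr hD)
        refine ⟨z, hz, fun s hs => ⟨x, ?_, hzE⟩⟩
        rintro _ ⟨D, hD, rfl⟩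
        refine hx _ (Or.inl ⟨D, ?_, rfl⟩)
        simp only [Finset.coe_biUnion, id_eq, Set.mem_iUnion]
        exact ⟨s, hs, hD⟩)
      refine ⟨{x | (d, x) ∈ E}, ⟨?_, ?_⟩, Or.inr ⟨d, hdB, Set.mem_insert _ _⟩⟩
      · rintro D (rfl | hD)
        · exact definable₁_section hE (hBA hdB)
        · exact hX D hD
      · rw [hins]
        intro G hG hfin
        have hfin' : (G ∩ (p ∪ X)).Finite := hfin.subset Set.inter_subset_left
        have := hfin'.fintype
        let s : Finset ↥(p ∪ X) :=
          (Finset.univ : Finset ↥(G ∩ (p ∪ X))).image fun D => ⟨D.1, D.2.2⟩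
        obtain ⟨x, hx, hxE⟩ := hd s
        refine ⟨x, fun D hD => ?_⟩
        rcases hG hD with rfl | hD'
        · exact hxE
        · refine hx D ⟨⟨D, hD'⟩, ?_, rfl⟩
          simp [s, hD]
  · refine ⟨fun D hD => hD.elim, ?_⟩
    rwa [Set.union_empty]

/-- Adding a realization of a type that decides everything about the predicate. -/
theorem Decides.pMeets {N' : Type u} [L.Structure N'] (f : N ↪ₑ[L] N') {A B : Set N} (hBA : B ⊆ A)
    {q : Set (Set N)} (hq : Decides P A B q) {c : N'}
    (hc : ∀ φ : L.Formula (A ⊕ Fin 1), {x : N | φ.Realize (Sum.elim (↑) fun _ => x)} ∈ q →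
      φ.Realize (Sum.elim (fun a : A => f a) fun _ => c)) :
    PMeets P (insert c (f '' A)) (f '' B) := by
  classical
  rintro D hD ⟨z, hzD, hzP⟩
  obtain ⟨φ, rfl⟩ := definable₁_iff.1 hD
  have hr : ∀ y : ↥(insert c (f '' A)), ∃ i : A ⊕ Fin 1,
      Sum.elim (fun a : A => f a) (fun _ => c) i = y := by
    rintro ⟨y, rfl | ⟨a, ha, rfl⟩⟩
    · exact ⟨Sum.inr 0, rfl⟩
    · exact ⟨Sum.inl ⟨a, ha⟩, rfl⟩
  choose r hr using hr
  -- Separates c from the other parameters: the given set is {z | ψ(z, c)} with ψ over A, so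
  -- `Decides` applies to the relation defined by ψ.
  let ψ : L.Formula (A ⊕ Fin 2) :=
    φ.relabel (Sum.elim (fun y => Sum.map id (fun _ => 1) (r y)) fun _ => Sum.inr 0)
  have hψ : ∀ z : N', ψ.Realize (Sum.elim (fun a : A => f a) ![z, c]) ↔
      φ.Realize (Sum.elim (↑) fun _ => z) := by
    intro z
    rw [Formula.realize_relabel]
    refine iff_of_eq (congrArg _ ?_)
    funext y
    rcases y with y | y
    · simp only [Function.comp_apply, Sum.elim_inl]
      rw [← hr y]
      rcases r y with i | i <;> rfl
    · rfl
  have hE : A.Definable₂ L {v : N × N | ψ.Realize (Sum.elim (fun a : A => (a : N)) ![v.1, v.2])} := by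
    refine Set.definable_iff_exists_formula_sum.2 ⟨ψ, ?_⟩
    ext v
    simp only [Set.mem_ofPred_eq]
    refine iff_of_eq (congrArg (fun w => ψ.Realize (Sum.elim _ w)) ?_)
    funext i
    fin_cases i <;> rfl
  rcases hq _ hE with h | ⟨d, hd, h⟩
  · exfalso
    let χ : L.Formula ((A ⊕ Fin 1) ⊕ Fin 1) := P.formula₁ (Term.var (Sum.inr 0)) ⊓
      ψ.relabel (Sum.elim (fun a => Sum.inl (Sum.inl a)) ![Sum.inr 0, Sum.inl (Sum.inr 0)])
    have hχ : ∀ {N : Type u} [L.Structure N] (g : A → N) (x : N),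
        ((χ.iExs (Fin 1)).not).Realize (Sum.elim g fun _ => x) ↔
          ¬ ∃ z ∈ predSet P N, ψ.Realize (Sum.elim g ![z, x]) := by
      intro N _ g x
      rw [Formula.realize_not, Formula.realize_iExs, not_iff_not]
      have key : ∀ u : Fin 1 → N, χ.Realize (Sum.elim (Sum.elim g fun _ => x) u) ↔
          u 0 ∈ predSet P N ∧ ψ.Realize (Sum.elim g ![u 0, x]) := by
        intro u
        rw [Formula.realize_inf, realize_formula₁_iff, Formula.realize_relabel]
        refine and_congr Iff.rfl (iff_of_eq (congrArg _ ?_))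
        funext i
        rcases i with i | i
        · rfl
        · fin_cases i <;> rfl
      constructor
      · rintro ⟨u, hu⟩
        exact ⟨u 0, (key u).1 hu⟩
      · rintro ⟨z, hz⟩
        exact ⟨fun _ => z, (key _).2 hz⟩
    have h1 := hc (χ.iExs (Fin 1)).not (by
      convert h using 1
      ext x
      exact hχ _ x)
    exact (hχ _ c).1 h1 ⟨z, hzP, (hψ z).2 hzD⟩
  · have key : ∀ {N : Type u} [L.Structure N] (g : A → N) (x : N),
        (ψ.relabel (Sum.elim Sum.inl ![Sum.inl ⟨d, hBA hd⟩, Sum.inr 0]) :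
          L.Formula (A ⊕ Fin 1)).Realize (Sum.elim g fun _ => x) ↔
          ψ.Realize (Sum.elim g ![g ⟨d, hBA hd⟩, x]) := by
      intro N _ g x
      rw [Formula.realize_relabel]
      refine iff_of_eq (congrArg _ ?_)
      funext i
      rcases i with i | i
      · rfl
      · fin_cases i <;> rfl
    have h1 := hc (ψ.relabel (Sum.elim Sum.inl ![Sum.inl ⟨d, hBA hd⟩, Sum.inr 0])) (by
      convert h using 1
      ext x
      exact key _ x)
    exact ⟨f d, (hψ _).1 ((key _ c).1 h1), d, hd, rfl⟩

end Extension

/-! ### Closing off to elementary substructures, and complete sets -/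

section Closure

variable {L : FirstOrder.Language.{u, u}} {T : L.Theory} {P : L.Relations 1}
variable {N : Type u} [L.Structure N]

theorem PMeets.anti {A A' B : Set N} (h : PMeets P A' B) (hA : A ⊆ A') : PMeets P A B :=
  fun D hD => h D (hD.mono hA)

/-- The family {D} extends to one that decides all A-definable relations. It has at most κ members,
so κ⁺-compactness realizes it inside N. -/
theorem exists_mem_pMeets_insert {κ : Cardinal.{u}} (hκ : theoryCard L < κ)
    (hN : DefCompact L (Order.succ κ) N) {A B : Set N} (h : PCompact P κ A B) (hBA : B ⊆ A)
    (hA : #A ≤ κ) {D : Set N} (hD : A.Definable₁ L D) (hne : D.Nonempty) :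
    ∃ c ∈ D, PMeets P (insert c A) B := by
  have h0 : ℵ₀ < κ := (le_max_left _ _).trans_lt hκ
  obtain ⟨q, hpq, hqA, hqF, hq⟩ := h.exists_decides hBA h0 hκ.le hA {D}
    (by rw [Cardinal.mk_singleton]; exact Cardinal.one_lt_aleph0.trans h0)
    (by rintro _ rfl; exact hD) (by
      intro G hG _
      obtain ⟨x, hx⟩ := hne
      refine ⟨x, fun E hE => ?_⟩
      rw [Set.mem_singleton_iff.1 (hG hE)]
      exact hx)
  obtain ⟨c, hc⟩ := hN q (Order.lt_succ_iff.2 ((Cardinal.mk_le_mk_of_subset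
      (fun D hD => hqA D hD : q ⊆ {D | A.Definable₁ L D})).trans
      (mk_definable₁_le.trans (max_le hκ.le hA))))
    (fun E hE => (hqA E hE).mono (Set.subset_univ _)) hqF
  refine ⟨c, hc D (hpq rfl), ?_⟩
  have := hq.pMeets (ElementaryEmbedding.refl L N) hBA (c := c) (fun φ hφ => hc _ hφ)
  have himg : ∀ X : Set N, ElementaryEmbedding.refl L N '' X = X := Set.image_id
  rwa [himg, himg] at this

/-- In a sufficiently compact model, a set whose definable sets meet `P` inside `B` is contained
in an elementary substructure with the same property. -/
theorem exists_meetsDefinable {κ : Cardinal.{u}} (hκ : theoryCard L < κ)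
    (hN : DefCompact L (Order.succ κ) N) {A B : Set N}
    (hB : ∀ A, B ⊆ A → PMeets P A B → PCompact P κ A B) (hBA : B ⊆ A) (hA : #A ≤ κ)
    (h : PMeets P A B) : ∃ A', A ⊆ A' ∧ PMeets P A' B ∧ L.MeetsDefinable A' := by
  have h0 : ℵ₀ < κ := (le_max_left _ _).trans_lt hκ
  -- One round puts a point into every nonempty set definable over the present A. New points create
  -- new definable sets, so ω rounds are taken; each definition in the union appears at a finite
  -- round.
  have round : ∀ A : {A : Set N // B ⊆ A ∧ #A ≤ κ ∧ PMeets P A B},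
      ∃ A' : {A : Set N // B ⊆ A ∧ #A ≤ κ ∧ PMeets P A B}, A.1 ⊆ A'.1 ∧
        ∀ D : Set N, D.Nonempty → A.1.Definable₁ L D → (D ∩ A'.1).Nonempty := by
    rintro ⟨A, hBA, hA, hAB⟩
    obtain ⟨X, hX, hXc, hXD⟩ := exists_good_all_done (α := N) (κ := κ)
      (ι := {D : {D : Set N | A.Definable₁ L D} // D.1.Nonempty})
      ((Cardinal.mk_subtype_le _).trans (mk_definable₁_le.trans (max_le hκ.le hA)))
      (fun X => PMeets P (A ∪ X) B) (fun D X => (D.1.1 ∩ X).Nonempty)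
      (fun D X Y hXY h => h.mono (Set.inter_subset_inter_right _ hXY))
      (by
        intro C hne hC hgood
        have hC' : IsChain (· ⊆ ·) ((fun X => A ∪ X) '' C) := by
          rintro _ ⟨X, hX, rfl⟩ _ ⟨Y, hY, rfl⟩ _
          rcases hC.total hX hY with h | h
          · exact Or.inl (Set.union_subset_union_right _ h)
          · exact Or.inr (Set.union_subset_union_right _ h)
        refine (PMeets.sUnion (hne.image _) hC' ?_).anti ?_
        · rintro _ ⟨X, hX, rfl⟩
          exact hgood X hX
        · rintro x (hx | ⟨X, hX, hx⟩)
          · exact ⟨_, ⟨_, hne.some_mem, rfl⟩, Or.inl hx⟩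
          · exact ⟨_, ⟨X, hX, rfl⟩, Or.inr hx⟩)
      (by
        rintro X hX hXc ⟨⟨D, hD⟩, hne⟩
        obtain ⟨c, hc, h⟩ := exists_mem_pMeets_insert hκ hN
          (hB _ (hBA.trans Set.subset_union_left) hX) (hBA.trans Set.subset_union_left)
          ((Cardinal.mk_union_le _ _).trans (Cardinal.add_le_of_le h0.le hA hXc.le))
          (hD.mono Set.subset_union_left) hne
        refine Or.inr ⟨c, ?_, ⟨c, hc, Set.mem_insert _ _⟩⟩
        rw [Set.union_insert]
        exact h)
      (by rwa [Set.union_empty])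
    refine ⟨⟨A ∪ X, hBA.trans Set.subset_union_left,
      (Cardinal.mk_union_le _ _).trans (Cardinal.add_le_of_le h0.le hA hXc), hX⟩,
      Set.subset_union_left, fun D hne hD => ?_⟩
    exact (hXD ⟨⟨D, hD⟩, hne⟩).mono (Set.inter_subset_inter_right _ Set.subset_union_right)
  choose next hnext hnextD using round
  let S : ℕ → {A : Set N // B ⊆ A ∧ #A ≤ κ ∧ PMeets P A B} := fun n =>
    Nat.rec ⟨A, hBA, hA, h⟩ (fun _ X => next X) n
  have hS : Monotone fun n => (S n).1 := monotone_nat_of_le_succ fun n => hnext (S n)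
  have hchain : IsChain (· ⊆ ·) (Set.range fun n => (S n).1) := hS.isChain_range
  refine ⟨⋃₀ Set.range fun n => (S n).1, ?_, ?_, ?_⟩
  · exact Set.subset_sUnion_of_mem ⟨0, rfl⟩
  · refine PMeets.sUnion (Set.range_nonempty _) hchain ?_
    rintro _ ⟨n, rfl⟩
    exact (S n).2.2.2
  · intro D hne hD
    obtain ⟨_, ⟨n, rfl⟩, hDn⟩ := exists_definable_of_sUnion (Set.range_nonempty _) hchain hD
    exact (hnextD (S n) D hne hDn).mono
      (Set.inter_subset_inter_right _ (Set.subset_sUnion_of_mem ⟨n + 1, rfl⟩))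

/-- With `IsCompleteSet.pMeets`, this translates between completeness, which concerns tuples, and
`PMeets`, which concerns single points of P. -/
theorem PMeets.isCompleteSet {A B : Set N} (h : PMeets P A B) (hBA : B ⊆ A)
    (hBP : B ⊆ predSet P N) : IsCompleteSet P A := by
  rintro m k ψ b hb ⟨a, haP, ha⟩
  have hW : A.Definable L {a : Fin m → N | ψ.Realize (Sum.elim a b)} := by
    have := definable_of_formula (A := A) (ψ.relabel Sum.swap) b hb
    convert this using 1
    ext a
    simp only [Set.mem_ofPred_eq, Formula.realize_relabel]
    refine iff_of_eq (congrArg ψ.Realize ?_)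
    funext i
    rcases i with i | i <;> rfl
  obtain ⟨w, hw, hwB⟩ := h.tuple hBA hW ⟨a, ha, haP⟩
  exact ⟨w, fun i => ⟨hBP (hwB i), hBA (hwB i)⟩, hw⟩

theorem IsCompleteSet.pMeets {A : Set N} (h : IsCompleteSet P A) :
    PMeets P A (predSet P N ∩ A) := by
  rintro D hD ⟨x, hxD, hxP⟩
  obtain ⟨A₀, hA₀, hDA⟩ := Set.definable_iff_finitely_definable.1 hD
  obtain ⟨φ, rfl⟩ := definable₁_iff.1 hDA
  let e : A₀ ≃ Fin (Fintype.card A₀) := Fintype.equivFin _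
  have key : ∀ a : Fin 1 → N, (φ.relabel (Sum.elim (fun i => Sum.inr (e i)) Sum.inl) :
      L.Formula (Fin 1 ⊕ Fin (Fintype.card A₀))).Realize
        (Sum.elim a fun j => (e.symm j : N)) ↔ φ.Realize (Sum.elim (↑) fun _ => a 0) := by
    intro a
    rw [Formula.realize_relabel]
    refine iff_of_eq (congrArg φ.Realize ?_)
    funext i
    rcases i with i | i
    · simp
    · rw [Subsingleton.elim i 0]; rfl
  obtain ⟨a, haP, ha⟩ := h 1 _ _ (fun j => (e.symm j : N)) (fun j => hA₀ (e.symm j).2)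
    ⟨fun _ => x, fun _ => hxP, (key _).2 hxD⟩
  exact ⟨a 0, (key a).1 ha, haP 0⟩

end Closure

/-! ### Nulldimensionality implies saturation -/

section Nulldimensional

variable {L : FirstOrder.Language.{u, u}} {T : L.Theory} {P : L.Relations 1}

theorem theoryCard_relPart_le : theoryCard (relPart L) ≤ theoryCard L := by
  refine max_le_max le_rfl ?_
  refine Cardinal.mk_le_of_injective
    (f := fun s : (relPart L).Symbols => (Sum.elim (fun f => (f.2 : PEmpty).elim) Sum.inr s :
      L.Symbols)) ?_
  rintro (⟨_, f⟩ | s) (⟨_, g⟩ | t) h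
  · exact (f : PEmpty).elim
  · exact (f : PEmpty).elim
  · exact (g : PEmpty).elim
  · exact congrArg Sum.inr (Sum.inr_injective h)

/-- A point over which the predicate does not grow has its type realized in the model. -/
theorem Nulldimensional.exists_type_eq (hnd : Nulldimensional T P)
    (M : Theory.ModelType.{u, u, u} T) {N : Type u} [L.Structure N] (f : M ↪ₑ[L] N) {c : N}
    {B : Set N} (h : PMeets P (insert c (Set.range f)) B) (hB : B ⊆ Set.range f)
    (hBP : B ⊆ predSet P N) :
    ∃ d : M, ∀ φ : L.Formula (M ⊕ Fin 1),
      φ.Realize (Sum.elim f fun _ => c) ↔ φ.Realize (Sum.elim id fun _ => d) := by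
  have hc : Set.range f ∪ Set.range (fun _ : Fin 1 => c) = insert c (Set.range f) := by
    rw [Set.range_const, Set.union_singleton]
  obtain ⟨d, hd⟩ := hnd M 1 (typeOver f fun _ => c) ⟨N, inferInstance, f, fun _ => c, rfl, by
    rw [hc]
    refine Set.Subset.antisymm (fun x hx => ⟨hx.1, hB (h.subset hx)⟩) ?_
    exact Set.inter_subset_inter_right _ (Set.subset_insert _ _), by
    rw [hc]
    exact h.isCompleteSet (hB.trans (Set.subset_insert _ _)) hBP⟩
  refine ⟨d 0, fun φ => ?_⟩
  have h1 := Set.ext_iff.1 hd φ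
  have h2 : d = fun _ => d 0 := funext fun i => by rw [Subsingleton.elim i 0]
  rw [h2] at h1
  exact h1

/-- Saturation of P^M allows every small consistent family over M to be completed to a type over
which P does not grow, and nulldimensionality realizes that type in M. -/
theorem Nulldimensional.isSaturatedOfCard (hT : StandingAssumptions T P)
    (hnd : Nulldimensional T P) {κ : Cardinal.{u}} (hκ : theoryCard L < κ)
    (M : Theory.ModelType.{u, u, u} T)
    (hM : IsSaturatedOfCard (relPart L) κ (predSet P M)) : IsSaturatedOfCard L κ M := by
  have h0 : ℵ₀ < κ := (le_max_left _ _).trans_lt hκ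
  have hP := (isKappaSaturated_iff_defCompact (theoryCard_relPart_le.trans_lt hκ)).1 hM.2
  have hcard : #M = κ := by
    obtain ⟨S, hS, hSc⟩ := exists_elementarySubstructure_card_eq L (predSet P M) κ h0.le
      (by simp [hM.1]) (by simpa using (le_max_right ℵ₀ L.card).trans hκ.le)
      (by simpa [← hM.1] using Cardinal.mk_set_le (predSet P M))
    rw [Cardinal.lift_id, Cardinal.lift_id] at hSc
    have hall : ∀ c : M, c ∈ S := by
      intro c
      -- All of P^M lies in S, so P trivially does not grow over S ∪ {c}. The formula x = d then
      -- gives c = d ∈ S.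
      obtain ⟨d, hd⟩ := hnd.exists_type_eq (S.toModel T) S.subtype (c := c) (B := predSet P M)
        (fun D _ h => h) (fun x hx => ⟨⟨x, hS hx⟩, rfl⟩) le_rfl
      have := (hd ((Term.var (Sum.inr 0)).equal (Term.var (Sum.inl d)))).2 (by
        simp [Formula.realize_equal])
      simp only [Formula.realize_equal, Term.realize_var, Sum.elim_inr, Sum.elim_inl] at this
      rw [this]
      exact Subtype.property (p := (· ∈ S)) d
    rw [← hSc]
    exact (Cardinal.mk_congr (Equiv.subtypeUnivEquiv hall)).symm
  refine ⟨hcard, (isKappaSaturated_iff_defCompact hκ).2 ?_⟩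
  intro F hF hFd hFF
  -- All of M is taken as parameter set, which is possible because |M| = κ was shown first. A
  -- realization of q, found in an elementary extension, is then brought back to M.
  obtain ⟨q, hpq, hqA, hqF, hq⟩ := (pCompact_univ hT M hP).exists_decides (Set.subset_univ _) h0
    hκ.le (by rw [Cardinal.mk_univ, hcard]) F hF hFd hFF
  obtain ⟨N, _, f, c, hc⟩ := exists_elementary_extension_realizing (L := L) (M := M) (n := 1)
    {φ : L.Formula (M ⊕ Fin 1) | {x : M | φ.Realize (Sum.elim id fun _ => x)} ∈ q} (by
      classical
      intro G hG
      obtain ⟨x, hx⟩ := hqF (G.image fun φ : L.Formula (M ⊕ Fin 1) => {x : M | φ.Realize (Sum.elim id fun _ => x)} :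
        Finset (Set M)) (by
          intro D hD
          obtain ⟨φ, hφ, rfl⟩ := Finset.mem_image.1 hD
          exact hG hφ) (Finset.finite_toSet _)
      exact ⟨fun _ => x, fun φ hφ => hx _ (Finset.mem_image_of_mem _ hφ)⟩)
  have hc0 : c = fun _ => c 0 := funext fun i => by rw [Subsingleton.elim i 0]
  rw [hc0] at hc
  have hrel : ∀ {K : Type u} [L.Structure K] (φ : L.Formula ((Set.univ : Set M) ⊕ Fin 1))
      (g : M → K) (x : K), (φ.relabel (Sum.map (↑) id) : L.Formula (M ⊕ Fin 1)).Realize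
        (Sum.elim g fun _ => x) ↔ φ.Realize (Sum.elim (fun a => g a) fun _ => x) := by
    intro K _ φ g x
    rw [Formula.realize_relabel, Sum.elim_comp_map]
    rfl
  have hreal : ∀ φ : L.Formula ((Set.univ : Set M) ⊕ Fin 1),
      {x : M | φ.Realize (Sum.elim (↑) fun _ => x)} ∈ q →
      φ.Realize (Sum.elim (fun a => f a) fun _ => c 0) := by
    intro φ hφ
    rw [← hrel]
    refine hc _ ?_
    have : {x : M | (φ.relabel (Sum.map (↑) id) : L.Formula (M ⊕ Fin 1)).Realize
        (Sum.elim id fun _ => x)} = {x : M | φ.Realize (Sum.elim (↑) fun _ => x)} := by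
      ext x
      exact hrel φ id x
    rw [Set.mem_ofPred_eq, this]
    exact hφ
  have hmeets := hq.pMeets f (Set.subset_univ _) hreal
  rw [Set.image_univ] at hmeets
  obtain ⟨d, hd⟩ := hnd.exists_type_eq M f hmeets (Set.image_subset_range _ _) (by
    rintro _ ⟨x, hx, rfl⟩
    exact (map_mem_predSet_iff f).2 hx)
  refine ⟨d, fun D hD => ?_⟩
  obtain ⟨φ, rfl⟩ := definable₁_iff.1 (hqA D (hpq hD))
  have h1 := (hrel φ f (c 0)).2 (hreal φ (hpq hD))
  exact (hrel φ id d).1 ((hd _).1 h1)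

end Nulldimensional

/-! ### Back and forth over an isomorphism of P-parts -/

section BackAndForth

variable {L : FirstOrder.Language.{u, u}} {T : L.Theory} {P : L.Relations 1}
variable {M₁ M₂ : Type u} [L.Structure M₁] [L.Structure M₂]

/-- A relation between two structures that preserves all formulas. -/
def ElemRel (L : FirstOrder.Language.{u, u}) {M₁ M₂ : Type u} [L.Structure M₁] [L.Structure M₂]
    (R : Set (M₁ × M₂)) : Prop :=
  ∀ φ : L.Formula R, φ.Realize (fun r => r.1.1) ↔ φ.Realize (fun r => r.1.2)

theorem ElemRel.realize_iff {R : Set (M₁ × M₂)} (h : ElemRel L R) {α : Type*} (φ : L.Formula α)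
    (t : α → M₁ × M₂) (ht : ∀ i, t i ∈ R) :
    φ.Realize (fun i => (t i).1) ↔ φ.Realize (fun i => (t i).2) := by
  have := h (φ.relabel fun i => ⟨t i, ht i⟩)
  rwa [Formula.realize_relabel, Formula.realize_relabel] at this

theorem ElemRel.swap {R : Set (M₁ × M₂)} (h : ElemRel L R) :
    ElemRel L (Prod.swap ⁻¹' R : Set (M₂ × M₁)) :=
  fun φ => (h.realize_iff φ (fun r => r.1.swap) fun r => r.2).symm

theorem elemRel_of_fin {R : Set (M₁ × M₂)}
    (h : ∀ (n : ℕ) (φ : L.Formula (Fin n)) (t : Fin n → M₁ × M₂), (∀ i, t i ∈ R) →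
      (φ.Realize (fun i => (t i).1) ↔ φ.Realize (fun i => (t i).2))) : ElemRel L R := by
  classical
  intro φ
  let e := Fintype.equivFin φ.freeVarFinset
  let f : φ.freeVarFinset → Fin (Fintype.card φ.freeVarFinset) := e
  have key : ∀ {K : Type u} [L.Structure K] (v : R → K),
      (φ.restrictFreeVar f).Realize (fun i => v (e.symm i)) default ↔ φ.Realize v := by
    intro K _ v
    exact BoundedFormula.realize_restrictFreeVar v (fun a => by simp [f])
  rw [← key, ← key]
  exact h _ (φ.restrictFreeVar f) (fun i => (e.symm i).1.1) (fun i => (e.symm i).1.2)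

theorem ElemRel.sUnion {C : Set (Set (M₁ × M₂))} (hne : C.Nonempty) (hC : IsChain (· ⊆ ·) C)
    (h : ∀ R ∈ C, ElemRel L R) : ElemRel L (⋃₀ C) := by
  classical
  refine elemRel_of_fin fun n φ t ht => ?_
  obtain ⟨R, hR, hsub⟩ := hC.directedOn.exists_mem_subset_of_finset_subset_biUnion (f := id)
    (s := Finset.univ.image t) hne (by
      rintro _ hx
      obtain ⟨i, rfl⟩ : ∃ i, t i = _ := by simpa using hx
      obtain ⟨R, hR, h⟩ := ht i
      exact Set.mem_biUnion hR h)
  exact (h R hR).realize_iff φ t fun i => hsub (by simp)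

/-- The graph of an isomorphism of `P`-parts. -/
def partGraph (e : predSet P M₁ ≃[relPart L] predSet P M₂) : Set (M₁ × M₂) :=
  Set.range fun x : predSet P M₁ => ((x : M₁), (e x : M₂))

/-- Formulas in at least one variable are relation symbols modulo T, which e preserves; for
sentences completeness of T is used. -/
theorem elemRel_partGraph (hT : StandingAssumptions T P) (M₁ M₂ : Theory.ModelType.{u, u, u} T)
    (e : predSet P M₁ ≃[relPart L] predSet P M₂) : ElemRel L (partGraph e) := by
  refine elemRel_of_fin fun n φ t ht => ?_
  choose z hz using ht
  obtain rfl : t = fun i => ((z i : M₁), (e (z i) : M₂)) := funext fun i => (hz i).symm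
  rcases n with _ | n
  · have key : ∀ (M : Theory.ModelType.{u, u, u} T) (v : Fin 0 → M), φ.Realize v ↔
        T ⊨ᵇ (φ.relabel (Fin.elim0 : Fin 0 → Empty) : L.Formula Empty) := by
      intro M v
      rw [← hT.complete.realize_sentence_iff _ M, Sentence.Realize, Formula.realize_relabel]
      exact iff_of_eq (congrArg _ (Subsingleton.elim _ _))
    rw [key, key]
  · obtain ⟨R, hR⟩ := hT.qe n φ
    have key : ∀ (M : Theory.ModelType.{u, u, u} T) (v : Fin (n + 1) → M),
        φ.Realize v ↔ Structure.RelMap R v := by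
      intro M v
      rw [hR.realize_iff, Formula.realize_rel]
      rfl
    rw [key, key]
    exact (e.map_rel (R : (relPart L).Relations (n + 1)) z).symm

/-- Counts the conditions on the image of a new point. Elements of P enter only through the k extra
variables, so the size of P plays no role. -/
theorem mk_sigma_formula_lt {α : Type u} {κ : Cardinal.{u}} (hκ : theoryCard L < κ)
    (hα : #α < κ) : #(Σ k : ℕ, L.Formula ((α ⊕ Fin 1) ⊕ Fin k)) < κ := by
  have h0 : ℵ₀ ≤ theoryCard L := le_max_left _ _
  have hα' : #(α ⊕ Fin 1 : Type u) < κ := by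
    rw [Cardinal.mk_sum]
    refine Cardinal.add_lt_of_lt (h0.trans hκ.le) (by simpa using hα) ?_
    exact lt_of_lt_of_le (by simp) (h0.trans hκ.le)
  rw [Cardinal.mk_sigma]
  refine (Cardinal.sum_le_sum _ (fun _ => max (theoryCard L) #(α ⊕ Fin 1 : Type u))
    fun k => mk_formula_sum_le).trans_lt ?_
  rw [Cardinal.sum_const]
  refine (Cardinal.mul_le_max _ _).trans_lt ?_
  simp only [Cardinal.mk_nat, Cardinal.lift_aleph0, Cardinal.lift_uzero]
  exact max_lt (max_lt (h0.trans_lt hκ) (max_lt hκ hα')) (h0.trans_lt hκ)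

/-- The extension step of the back-and-forth argument. -/
theorem exists_elemRel_insert (hT : StandingAssumptions T P)
    (M₁ M₂ : Theory.ModelType.{u, u, u} T) {κ : Cardinal.{u}} (hκ : theoryCard L < κ)
    (hM₂ : DefCompact L κ M₂) (e : predSet P M₁ ≃[relPart L] predSet P M₂)
    {A : Set (M₁ × M₂)} (hA : #A < κ) (h : ElemRel L (partGraph e ∪ A)) (a : M₁) :
    ∃ b : M₂, ElemRel L (partGraph e ∪ insert (a, b) A) := by
  classical
  let ι := Σ k : ℕ, L.Formula ((A ⊕ Fin 1) ⊕ Fin k)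
  -- Stable embeddedness: the truth of φ(A, a, z) for z in P has a definition χ over P.
  have hχ : ∀ i : ι, ∃ χ : L.Formula (predSet P M₁ ⊕ Fin i.1), ∀ z : Fin i.1 → M₁,
      (∀ j, z j ∈ predSet P M₁) →
      (i.2.Realize (Sum.elim (Sum.elim (fun p => p.1.1) fun _ => a) z) ↔
        χ.Realize (Sum.elim (↑) z)) := by
    rintro ⟨k, φ⟩
    have h1 : (Set.univ : Set M₁).Definable L {z : Fin k → M₁ |
        φ.Realize (Sum.elim (Sum.elim (fun p => p.1.1) fun _ => a) z)} :=
      definable_of_formula φ _ fun _ => trivial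
    have h2 : (Set.univ : Set M₁).Definable L (⋂ j : Fin k, {z : Fin k → M₁ |
        z j ∈ predSet P M₁}) :=
      Set.definable_iInter_of_finite fun j =>
        (definable₁_predSet P).preimage_comp fun _ : Fin 1 => j
    obtain ⟨χ, hχ⟩ := Set.definable_iff_exists_formula_sum.1
      (hT.stably_embedded M₁ k _ (fun z hz i => Set.mem_iInter.1 hz.2 i) (h1.inter h2))
    refine ⟨χ, fun z hz => ?_⟩
    have := Set.ext_iff.1 hχ z
    exact ⟨fun h => this.1 ⟨h, Set.mem_iInter.2 hz⟩, fun h => (this.2 h).1⟩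
  choose χ hχ using hχ
  -- Asserts of the new point that χ still defines φ on P. Its consistency in M₂ is transferred
  -- along the given elementary relation, with a as witness in M₁.
  let Θ : ι → L.Formula ((A ⊕ predSet P M₁) ⊕ Fin 1) := fun i =>
    Formula.iAlls (Fin i.1) ((Formula.iInf fun j : Fin i.1 =>
        P.formula₁ (Term.var (Sum.inr j) : L.Term (((A ⊕ predSet P M₁) ⊕ Fin 1) ⊕ Fin i.1))).imp
      ((i.2.relabel (Sum.map (Sum.map Sum.inl id) id)).iff
        ((χ i).relabel (Sum.map (fun x => Sum.inl (Sum.inr x)) id))))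
  have hΘ : ∀ (i : ι) {K : Type u} [L.Structure K] (g : A → K) (g' : predSet P M₁ → K) (b : K),
      (Θ i).Realize (Sum.elim (Sum.elim g g') fun _ => b) ↔ ∀ z : Fin i.1 → K,
        (∀ j, z j ∈ predSet P K) →
        (i.2.Realize (Sum.elim (Sum.elim g fun _ => b) z) ↔
          (χ i).Realize (Sum.elim g' z)) := by
    intro i K _ g g' b
    rw [Formula.realize_iAlls]
    refine forall_congr' fun z => ?_
    rw [Formula.realize_imp, Formula.realize_iInf, Formula.realize_iff, Formula.realize_relabel,
      Formula.realize_relabel]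
    refine imp_congr (forall_congr' fun j => ?_) (iff_congr ?_ ?_)
    · rw [realize_formula₁_iff]
      rfl
    · refine iff_of_eq (congrArg _ ?_)
      funext x
      rcases x with (x | x) | x <;> rfl
    · refine iff_of_eq (congrArg _ ?_)
      funext x
      rcases x with x | x <;> rfl
  obtain ⟨b, hb⟩ := hM₂.indexed (mk_sigma_formula_lt hκ hA : #ι < κ)
    (fun i => {b | (Θ i).Realize (Sum.elim (Sum.elim (fun p => p.1.2) fun x => (e x : M₂))
      fun _ => b)}) (by
      intro i
      refine definable₁_iff.2 ⟨(Θ i).relabel (Sum.map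
        (fun y => ⟨Sum.elim (fun p => p.1.2) (fun x => (e x : M₂)) y, trivial⟩) id), ?_⟩
      ext b
      simp only [Set.mem_ofPred_eq, Formula.realize_relabel, Sum.elim_comp_map]
      rfl) (by
      intro s
      have key : ∀ {K : Type u} [L.Structure K] (g : A ⊕ predSet P M₁ → K),
          (Formula.iExs (Fin 1) (Formula.iInf fun i : s => Θ i)).Realize g ↔
            ∃ b : K, ∀ i ∈ s, (Θ i).Realize (Sum.elim g fun _ => b) := by
        intro K _ g
        rw [Formula.realize_iExs]
        constructor
        · rintro ⟨u, hu⟩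
          rw [Formula.realize_iInf] at hu
          refine ⟨u 0, fun i hi => ?_⟩
          have := hu ⟨i, hi⟩
          have hu0 : u = fun _ => u 0 := funext fun i => by rw [Subsingleton.elim i 0]
          rw [hu0] at this
          exact this
        · rintro ⟨b, hb⟩
          refine ⟨fun _ => b, ?_⟩
          rw [Formula.realize_iInf]
          exact fun i => hb i i.2
      have htrans := h.realize_iff (Formula.iExs (Fin 1) (Formula.iInf fun i : s => Θ i))
        (Sum.elim (fun p : A => p.1) fun x : predSet P M₁ => ((x : M₁), (e x : M₂))) (by
          rintro (p | x)
          · exact Or.inr p.2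
          · exact Or.inl ⟨x, rfl⟩)
      have e1 : (fun i => (Sum.elim (fun p : A => p.1)
          (fun x : predSet P M₁ => ((x : M₁), (e x : M₂))) i).1) =
          Sum.elim (fun p : A => p.1.1) fun x : predSet P M₁ => (x : M₁) := by
        funext i; rcases i with i | i <;> rfl
      have e2 : (fun i => (Sum.elim (fun p : A => p.1)
          (fun x : predSet P M₁ => ((x : M₁), (e x : M₂))) i).2) =
          Sum.elim (fun p : A => p.1.2) fun x => (e x : M₂) := by
        funext i; rcases i with i | i <;> rfl
      rw [e1, e2, key, key] at htrans
      exact htrans.1 ⟨a, fun i _ => (hΘ i _ _ a).2 (hχ i)⟩)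
  refine ⟨b, fun φ => ?_⟩
  let V := φ.freeVarFinset
  let ε : V ≃ Fin (Fintype.card V) := Fintype.equivFin V
  obtain ⟨x₀, hx₀⟩ := nonempty_predSet hT M₁
  -- Preimages under e of the variables taken from its graph. The default x₀ fills slots to which
  -- `f` sends nothing.
  let z : Fin (Fintype.card V) → predSet P M₁ := fun j =>
    if hj : (ε.symm j).1.1 ∈ partGraph e then hj.choose else ⟨x₀, hx₀⟩
  have hz : ∀ r : V, r.1.1 ∈ partGraph e →
      ((z (ε r) : M₁), (e (z (ε r)) : M₂)) = r.1.1 := by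
    intro r hr
    have hr' : (ε.symm (ε r)).1.1 ∈ partGraph e := by rwa [Equiv.symm_apply_apply]
    simp only [z, dif_pos hr']
    refine hr'.choose_spec.trans ?_
    rw [Equiv.symm_apply_apply]
  let f : V → (A ⊕ Fin 1) ⊕ Fin (Fintype.card V) := fun r =>
    if r.1.1 ∈ partGraph e then Sum.inr (ε r)
    else if hA : r.1.1 ∈ A then Sum.inl (Sum.inl ⟨r.1.1, hA⟩) else Sum.inl (Sum.inr 0)
  have hf : ∀ {K : Type u} (π : M₁ × M₂ → K) (r : V),
      Sum.elim (Sum.elim (fun p : A => π p.1) fun _ => π (a, b))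
        (fun j => π ((z j : M₁), (e (z j) : M₂))) (f r) = π r.1.1 := by
    intro K π r
    by_cases h1 : r.1.1 ∈ partGraph e
    · simp only [f, if_pos h1, Sum.elim_inr, hz r h1]
    · by_cases h2 : r.1.1 ∈ A
      · simp only [f, if_neg h1, dif_pos h2, Sum.elim_inl]
      · simp only [f, if_neg h1, dif_neg h2, Sum.elim_inl, Sum.elim_inr]
        rcases r.1.2 with h3 | h3 | h3
        · exact absurd h3 h1
        · rw [h3]
        · exact absurd h3 h2
  let i : ι := ⟨Fintype.card V, φ.restrictFreeVar f⟩
  have hφ₁ : i.2.Realize (Sum.elim (Sum.elim (fun p => p.1.1) fun _ => a) fun j => (z j : M₁)) ↔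
      φ.Realize fun r => r.1.1 :=
    BoundedFormula.realize_restrictFreeVar _ fun r => hf Prod.fst r
  have hφ₂ : i.2.Realize (Sum.elim (Sum.elim (fun p => p.1.2) fun _ => b)
      fun j => (e (z j) : M₂)) ↔ φ.Realize fun r => r.1.2 :=
    BoundedFormula.realize_restrictFreeVar _ fun r => hf Prod.snd r
  have hmid := h.realize_iff (χ i) (Sum.elim (fun x : predSet P M₁ => ((x : M₁), (e x : M₂)))
    fun j => ((z j : M₁), (e (z j) : M₂))) (by
      rintro (x | j)
      · exact Or.inl ⟨x, rfl⟩
      · exact Or.inl ⟨z j, rfl⟩)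
  have e1 : (fun y => (Sum.elim (fun x : predSet P M₁ => ((x : M₁), (e x : M₂)))
      (fun j => ((z j : M₁), (e (z j) : M₂))) y).1) =
      Sum.elim (fun x : predSet P M₁ => (x : M₁)) fun j => (z j : M₁) := by
    funext y; rcases y with y | y <;> rfl
  have e2 : (fun y => (Sum.elim (fun x : predSet P M₁ => ((x : M₁), (e x : M₂)))
      (fun j => ((z j : M₁), (e (z j) : M₂))) y).2) =
      Sum.elim (fun x => (e x : M₂)) fun j => (e (z j) : M₂) := by
    funext y; rcases y with y | y <;> rfl
  rw [e1, e2] at hmid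
  rw [← hφ₁, ← hφ₂, hχ i _ fun j => (z j).2, hmid]
  exact ((hΘ i _ _ b).1 (hb i) _ fun j => (e (z j)).2).symm

/-- Two saturated models of the same cardinality are isomorphic over any isomorphism of their
`P`-parts. -/
theorem exists_equiv_extending (hT : StandingAssumptions T P)
    (M₁ M₂ : Theory.ModelType.{u, u, u} T) {κ : Cardinal.{u}} (hκ : theoryCard L < κ)
    (hM₁ : DefCompact L κ M₁) (hM₂ : DefCompact L κ M₂) (hc₁ : #M₁ = κ) (hc₂ : #M₂ = κ)
    (e : predSet P M₁ ≃[relPart L] predSet P M₂) :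
    ∃ g : M₁ ≃[L] M₂, ∀ x : predSet P M₁, g (x : M₁) = (e x : M₂) := by
  have h0 : ℵ₀ ≤ κ := (le_max_left _ _).trans hκ.le
  have hswap : ∀ A : Set (M₁ × M₂), (Prod.swap ⁻¹' (partGraph e ∪ A) : Set (M₂ × M₁)) =
      partGraph e.symm ∪ Prod.swap ⁻¹' A := by
    intro A
    rw [Set.preimage_union]
    congr 1
    ext ⟨y, x⟩
    constructor
    · rintro ⟨x, hx⟩
      obtain ⟨rfl, rfl⟩ := Prod.ext_iff.1 hx
      exact ⟨e x, by simp⟩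
    · rintro ⟨y, hy⟩
      obtain ⟨rfl, rfl⟩ := Prod.ext_iff.1 hy
      exact ⟨e.symm y, by simp⟩
  obtain ⟨A, hA, -, hdone⟩ := exists_good_all_done (α := M₁ × M₂) (ι := M₁ ⊕ M₂) (κ := κ)
    (by rw [Cardinal.mk_sum, Cardinal.lift_id, Cardinal.lift_id, hc₁, hc₂, Cardinal.add_eq_self h0])
    (fun A => ElemRel L (partGraph e ∪ A))
    (fun t A => Sum.elim (fun a => ∃ b, (a, b) ∈ A) (fun b => ∃ a, (a, b) ∈ A) t)
    (by
      rintro (a | b) A B hAB ⟨c, hc⟩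
      · exact ⟨c, hAB hc⟩
      · exact ⟨c, hAB hc⟩)
    (by
      intro C hne hC hgood
      have hC' : IsChain (· ⊆ ·) ((fun A => partGraph e ∪ A) '' C) := by
        rintro _ ⟨X, hX, rfl⟩ _ ⟨Y, hY, rfl⟩ _
        rcases hC.total hX hY with h | h
        · exact Or.inl (Set.union_subset_union_right _ h)
        · exact Or.inr (Set.union_subset_union_right _ h)
      have h1 : ElemRel L (⋃₀ ((fun A => partGraph e ∪ A) '' C)) :=
        ElemRel.sUnion (hne.image _) hC' (by
          rintro _ ⟨X, hX, rfl⟩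
          exact hgood X hX)
      convert h1 using 1
      ext p
      simp only [Set.mem_union, Set.mem_sUnion, Set.exists_mem_image]
      constructor
      · rintro (hp | ⟨X, hX, hp⟩)
        · exact ⟨_, hne.some_mem, Or.inl hp⟩
        · exact ⟨X, hX, Or.inr hp⟩
      · rintro ⟨X, hX, hp | hp⟩
        · exact Or.inl hp
        · exact Or.inr ⟨X, hX, hp⟩)
    (by
      rintro A hA hcard (a | b)
      · obtain ⟨b, hb⟩ := exists_elemRel_insert hT M₁ M₂ hκ hM₂ e hcard hA a
        exact Or.inr ⟨(a, b), hb, b, Set.mem_insert _ _⟩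
      · have h1 := hA.swap
        rw [hswap] at h1
        obtain ⟨a, ha⟩ := exists_elemRel_insert hT M₂ M₁ hκ hM₁ e.symm
          (A := Prod.swap ⁻¹' A)
          ((Cardinal.mk_preimage_equiv (Equiv.prodComm M₂ M₁) A).trans_lt hcard) h1 b
        refine Or.inr ⟨(a, b), ?_, a, Set.mem_insert _ _⟩
        have h2 := ha.swap
        have h3 : insert (b, a) (Prod.swap ⁻¹' A) =
            (Prod.swap ⁻¹' (insert (a, b) A) : Set (M₂ × M₁)) := by
          ext ⟨y, x⟩
          simp [Prod.ext_iff, and_comm]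
        rw [h3, ← hswap, ← Set.preimage_comp, Prod.swap_swap_eq, Set.preimage_id] at h2
        exact h2)
    (by
      rw [Set.union_empty]
      exact elemRel_partGraph hT M₁ M₂ e)
  choose f hf using fun a => hdone (Sum.inl a)
  -- Preserving equality makes the relation the graph of a function, which must extend e.
  have huniq : ∀ a b, (a, b) ∈ partGraph e ∪ A → f a = b := by
    intro a b hab
    have := hA.realize_iff ((Term.var 0).equal (Term.var 1) : L.Formula (Fin 2))
      ![(a, f a), (a, b)] (by
        intro i
        fin_cases i
        · exact Or.inr (hf a)
        · exact hab)
    simpa [Formula.realize_equal] using this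
  let F : M₁ ↪ₑ[L] M₂ := elementaryOfFormulas f fun φ hφ =>
    (hA.realize_iff φ (fun a => (a, f a)) fun a => Or.inr (hf a)).1 hφ
  have hsurj : Function.Surjective F := fun b => by
    obtain ⟨a, ha⟩ := hdone (Sum.inr b)
    exact ⟨a, huniq a b (Or.inr ha)⟩
  exact ⟨⟨Equiv.ofBijective F ⟨F.injective, hsurj⟩, fun g x => F.map_fun g x,
    fun R x => F.map_rel R x⟩, fun x => huniq x (e x) (Or.inl ⟨x, rfl⟩)⟩

end BackAndForth

/-! ### Compact pairs of a model and an elementary substructure -/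

section Pairs

variable {L : FirstOrder.Language.{u, u}} {P : L.Relations 1}

/-- A language without function symbols and with one relation symbol of each arity. -/
def markerLanguage : FirstOrder.Language.{u, u} := ⟨fun _ => PEmpty, fun _ => PUnit⟩

/-- The language `L` with an additional unary predicate, the marker. -/
abbrev pairLanguage (L : FirstOrder.Language.{u, u}) : FirstOrder.Language.{u, u} :=
  L.sum markerLanguage.{u}

/-- The additional unary predicate. -/
def marker (L : FirstOrder.Language.{u, u}) : (pairLanguage L).Relations 1 := Sum.inr PUnit.unit

theorem theoryCard_pairLanguage_le : theoryCard (pairLanguage L) ≤ theoryCard L := by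
  have h0 : ℵ₀ ≤ theoryCard L := le_max_left _ _
  refine max_le h0 ?_
  rw [Language.card_sum, Cardinal.lift_id, Cardinal.lift_id]
  refine Cardinal.add_le_of_le h0 (le_max_right _ _) (le_trans ?_ h0)
  have : Countable (markerLanguage.{u}).Symbols := by
    have h1 : ∀ n, Countable ((markerLanguage.{u}).Functions n) := fun n =>
      inferInstanceAs (Countable PEmpty)
    have h2 : ∀ n, Countable ((markerLanguage.{u}).Relations n) := fun n =>
      inferInstanceAs (Countable PUnit)
    unfold Language.Symbols
    infer_instance
  exact Cardinal.mk_le_aleph0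

theorem exists_formula_of_definable_insert {M : Type u} [L.Structure M] {c : M} {Q : Set M}
    (hQ : Q.Nonempty) {D : Set M} (hD : (insert c Q).Definable₁ L D) :
    ∃ (k : ℕ) (b : Fin k → M) (φ : L.Formula ((PUnit.{u + 1} ⊕ Fin k) ⊕ Fin 1)),
      (∀ j, b j ∈ Q) ∧
      D = {x | φ.Realize (Sum.elim (Sum.elim (fun _ => c) b) fun _ => x)} := by
  classical
  obtain ⟨A, hA, hDA⟩ := Set.definable_iff_finitely_definable.1 hD
  obtain ⟨φ, rfl⟩ := definable₁_iff.1 hDA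
  obtain ⟨q, hq⟩ := hQ
  let e : A ≃ Fin (Fintype.card A) := Fintype.equivFin A
  -- The slots belonging to c are filled with the default q ∈ Q; `f` sends c to its own slot
  -- instead, unless c lies in Q.
  let b : Fin (Fintype.card A) → M := fun j => if (e.symm j : M) ∈ Q then e.symm j else q
  let f : A → PUnit.{u + 1} ⊕ Fin (Fintype.card A) := fun a =>
    if (a : M) ∈ Q then Sum.inr (e a) else Sum.inl PUnit.unit
  have hf : ∀ a : A, Sum.elim (fun _ => c) b (f a) = a := by
    intro a
    by_cases h : (a : M) ∈ Q
    · simp [f, b, h]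
    · simp only [f, if_neg h, Sum.elim_inl]
      exact ((hA a.2).resolve_right h).symm
  refine ⟨Fintype.card A, b, φ.relabel (Sum.map f id), fun j => ?_, ?_⟩
  · simp only [b]
    split_ifs with h
    · exact h
    · exact hq
  · ext x
    simp only [Set.mem_ofPred_eq, Formula.realize_relabel, Sum.elim_comp_map]
    refine iff_of_eq (congrArg (fun g => φ.Realize (Sum.elim g _)) ?_)
    funext a
    exact (hf a).symm

/-- If `φ(c, b, x)` with `b` in the marker has a solution, then it has one in the marker. -/
noncomputable def markerFormula {k : ℕ}
    (φ : (pairLanguage L).Formula ((PUnit.{u + 1} ⊕ Fin k) ⊕ Fin 1)) :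
    (pairLanguage L).Formula PUnit.{u + 1} :=
  Formula.iAlls (Fin k) ((Formula.iInf fun j : Fin k =>
      (marker L).formula₁ (Term.var (Sum.inr j))).imp
    ((Formula.iExs (Fin 1) φ).imp
      (Formula.iExs (Fin 1) (φ ⊓ (marker L).formula₁ (Term.var (Sum.inr 0))))))

theorem realize_markerFormula {K : Type u} [(pairLanguage L).Structure K] {k : ℕ}
    (φ : (pairLanguage L).Formula ((PUnit.{u + 1} ⊕ Fin k) ⊕ Fin 1)) (c : K) :
    (markerFormula φ).Realize (fun _ => c) ↔ ∀ b : Fin k → K,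
      (∀ j, b j ∈ predSet (marker L) K) →
      (∃ x, φ.Realize (Sum.elim (Sum.elim (fun _ => c) b) fun _ => x)) →
      ∃ x ∈ predSet (marker L) K,
        φ.Realize (Sum.elim (Sum.elim (fun _ => c) b) fun _ => x) := by
  have hconst : ∀ u : Fin 1 → K, u = fun _ => u 0 := fun u =>
    funext fun i => by rw [Subsingleton.elim i 0]
  rw [markerFormula, Formula.realize_iAlls]
  refine forall_congr' fun b => ?_
  rw [Formula.realize_imp, Formula.realize_imp, Formula.realize_iInf, Formula.realize_iExs,
    Formula.realize_iExs]
  refine imp_congr (forall_congr' fun j => ?_) (imp_congr ?_ ?_)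
  · rw [realize_formula₁_iff]
    rfl
  · constructor
    · rintro ⟨u, hu⟩
      refine ⟨u 0, ?_⟩
      rw [hconst u] at hu
      exact hu
    · rintro ⟨x, hx⟩
      exact ⟨fun _ => x, hx⟩
  · constructor
    · rintro ⟨u, hu⟩
      rw [Formula.realize_inf, realize_formula₁_iff] at hu
      refine ⟨u 0, hu.2, ?_⟩
      have := hu.1
      rw [hconst u] at this
      exact this
    · rintro ⟨x, hxq, hx⟩
      refine ⟨fun _ => x, ?_⟩
      rw [Formula.realize_inf, realize_formula₁_iff]
      exact ⟨hx, hxq⟩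

/-- If cof κ < κ, then κ < κ^{cof κ} ≤ κ^{<κ}. -/
theorem isRegular_of_powerlt_eq {κ : Cardinal.{u}} (h0 : ℵ₀ ≤ κ) (h : κ ^< κ = κ) :
    κ.IsRegular := by
  refine ⟨h0, ?_⟩
  by_contra! hc
  exact absurd (Cardinal.lt_power_cof_ord h0) (not_lt.2 ((Cardinal.le_powerlt κ hc).trans h.le))

/-- Existence of a compact pair: the elementary substructure `Q` and the point `c` over which `P`
does not grow are replaced by a saturated elementary substructure and such a point. -/
theorem exists_compact_pair {κ : Cardinal.{u}} (hκ : theoryCard L < κ) (hpow : κ ^< κ = κ)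
    {N₀ : Type u} [L.Structure N₀] {Q : Set N₀} (hQne : Q.Nonempty) (hQ : L.MeetsDefinable Q)
    {c : N₀} (hc : c ∉ Q) (h : PMeets P (insert c Q) (predSet P N₀ ∩ Q)) :
    ∃ (N : Type u) (_ : L.Structure N) (S : L.ElementarySubstructure N) (c' : N),
      (N₀ ≅[L] N) ∧ #N ≤ κ ∧ DefCompact L κ S ∧ c' ∉ S ∧
      PMeets P (insert c' (S : Set N)) (predSet P N ∩ S) := by
  have h0 : ℵ₀ < κ := (le_max_left _ _).trans_lt hκ
  have hne : Nonempty N₀ := ⟨c⟩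
  let _ : (markerLanguage.{u}).Structure N₀ :=
    { funMap := fun f => (f : PEmpty).elim, RelMap := fun _ v => ∀ i, v i ∈ Q }
  have hq₀ : predSet (marker L) N₀ = Q := by
    ext x
    have : x ∈ predSet (marker L) N₀ ↔ ∀ i : Fin 1, (![x] : Fin 1 → N₀) i ∈ Q := Iff.rfl
    rw [this]
    simp
  obtain ⟨N, iN, w, hcard, hcomp, hw⟩ := exists_defCompact (L := pairLanguage L)
    (Y := PUnit.{u + 1}) (fun _ => c) (κ := κ) (θ := κ)
    (by rw [Cardinal.mk_punit]; exact (Cardinal.one_lt_aleph0.trans h0).le)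
    (theoryCard_pairLanguage_le.trans hκ.le) h0 le_rfl
    (Or.inr (isRegular_of_powerlt_eq h0.le hpow)) hpow.le
  let _ : L.Structure N := (LHom.sumInl : L →ᴸ pairLanguage L).reduct N
  let c' : N := w PUnit.unit
  have hw' : ∀ φ : (pairLanguage L).Formula PUnit.{u + 1},
      φ.Realize (fun _ => c) ↔ φ.Realize (fun _ => c') := by
    intro φ
    refine ⟨fun hφ => hw φ hφ, fun hφ => by_contra fun hn => ?_⟩
    have := hw φ.not hn
    exact this hφ
  let Q' : Set N := predSet (marker L) N
  -- That solvable formulas over c and the marker have solutions in the marker is, for each φ, part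
  -- of the type of c in the pair language.
  have hax : ∀ {k : ℕ} (φ : L.Formula ((PUnit.{u + 1} ⊕ Fin k) ⊕ Fin 1)),
      (∀ b : Fin k → N₀, (∀ j, b j ∈ Q) →
        (∃ x, φ.Realize (Sum.elim (Sum.elim (fun _ => c) b) fun _ => x)) →
        ∃ x ∈ Q, φ.Realize (Sum.elim (Sum.elim (fun _ => c) b) fun _ => x)) →
      ∀ b : Fin k → N, (∀ j, b j ∈ Q') →
        (∃ x, φ.Realize (Sum.elim (Sum.elim (fun _ => c') b) fun _ => x)) →
        ∃ x ∈ Q', φ.Realize (Sum.elim (Sum.elim (fun _ => c') b) fun _ => x) := by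
    intro k φ hφ
    have h1 := (realize_markerFormula
      ((LHom.sumInl : L →ᴸ pairLanguage L).onFormula φ) c).2 (by
        simp only [LHom.realize_onFormula, hq₀]
        exact hφ)
    have h2 := (realize_markerFormula _ c').1 ((hw' _).1 h1)
    simp only [LHom.realize_onFormula] at h2
    exact h2
  have hQ'ne : Q'.Nonempty := by
    obtain ⟨q, hq⟩ := hQne
    obtain ⟨x, hx, _⟩ := hax (k := 0) ⊤ (fun _ _ _ => ⟨q, hq, by simp⟩) Fin.elim0
      (fun j => j.elim0) ⟨c', by simp⟩
    exact ⟨x, hx⟩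
  have hQ' : L.MeetsDefinable Q' := by
    rintro D ⟨x, hx⟩ hD
    obtain ⟨k, b, φ, hb, rfl⟩ := exists_formula_of_definable_insert (c := hQ'ne.some) hQ'ne
      (hD.mono (Set.subset_insert _ _))
    -- Here the distinguished point came from Q' itself. It is moved to an additional marker
    -- coordinate so that the formula does not involve c', and elementarity of Q in N₀ verifies the
    -- schema.
    let ψ : L.Formula ((PUnit.{u + 1} ⊕ Fin (k + 1)) ⊕ Fin 1) :=
      φ.relabel (Sum.map (Sum.elim (fun _ => Sum.inr 0) fun j => Sum.inr j.succ) id)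
    have hψ : ∀ {K : Type u} [L.Structure K] (c : K) (b : Fin (k + 1) → K) (x : K),
        ψ.Realize (Sum.elim (Sum.elim (fun _ => c) b) fun _ => x) ↔
          φ.Realize (Sum.elim (Sum.elim (fun _ => b 0) (Fin.tail b)) fun _ => x) := by
      intro K _ c b x
      rw [Formula.realize_relabel]
      refine iff_of_eq (congrArg _ ?_)
      funext i
      rcases i with (i | i) | i <;> rfl
    have h1 := hax ψ (by
      rintro b hb ⟨x, hx⟩
      have hdef : Q.Definable₁ L
          {x | φ.Realize (Sum.elim (Sum.elim (fun _ => b 0) (Fin.tail b)) fun _ => x)} := by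
        refine definable₁_iff.2 ⟨φ.relabel (Sum.map (Sum.elim (fun _ => ⟨b 0, hb 0⟩)
          fun j => ⟨b j.succ, hb _⟩) id), ?_⟩
        ext x
        simp only [Set.mem_ofPred_eq, Formula.realize_relabel, Sum.elim_comp_map]
        refine iff_of_eq (congrArg _ ?_)
        funext i
        rcases i with (i | i) | i <;> rfl
      obtain ⟨y, hy, hyQ⟩ := hQ _ ⟨x, (hψ _ _ _).1 hx⟩ hdef
      exact ⟨y, hyQ, (hψ _ _ _).2 hy⟩) (Fin.cons hQ'ne.some b) (by
        intro j
        refine Fin.cases hQ'ne.some_mem (fun j => hb j) j) ⟨x, (hψ _ _ _).2 hx⟩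
    obtain ⟨y, hyQ, hy⟩ := h1
    exact ⟨y, (hψ _ _ _).1 hy, hyQ⟩
  let S := hQ'.toElementarySubstructure
  have hS : (S : Set N) = Q' := hQ'.closure_eq_self
  have hmem : ∀ x, x ∈ S ↔ x ∈ Q' := fun x => Set.ext_iff.1 hS x
  refine ⟨N, inferInstance, S, c', ?_, hcard, ?_, ?_, ?_⟩
  · rw [elementarilyEquivalent_iff]
    intro σ
    have h1 := hw' ((LHom.sumInl : L →ᴸ pairLanguage L).onFormula
      (σ.relabel (Empty.elim : Empty → PUnit.{u + 1})))
    rw [LHom.realize_onFormula, LHom.realize_onFormula, Formula.realize_relabel,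
      Formula.realize_relabel] at h1
    rw [Sentence.Realize, Sentence.Realize]
    convert h1 using 2
  · intro F hF hFd hFF
    have : ∀ D : F, ∃ φ : L.Formula ((Set.univ : Set S) ⊕ Fin 1),
        D.1 = {x | φ.Realize (Sum.elim (↑) fun _ => x)} := fun D => definable₁_iff.1 (hFd D D.2)
    choose φ hφ using this
    have hreal : ∀ (D : F) (x : S), x ∈ D.1 ↔
        (φ D).Realize (Sum.elim (fun a => ((a : S) : N)) fun _ => (x : N)) := by
      intro D x
      rw [hφ]
      refine (S.subtype.map_formula (φ D) _).symm.trans (iff_of_eq (congrArg _ ?_))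
      funext i
      rcases i with i | i <;> rfl
    -- The index `none` carries the marker, forcing the common point into S.
    obtain ⟨x, hx⟩ := hcomp.indexed (ι := Option F)
      (by
        rw [Cardinal.mk_option]
        exact Cardinal.add_lt_of_lt h0.le hF (Cardinal.one_lt_aleph0.trans h0))
      (fun o => o.elim Q' fun D =>
        {x | (φ D).Realize (Sum.elim (fun a => ((a : S) : N)) fun _ => x)}) (by
        rintro (_ | D)
        · exact definable₁_predSet (marker L)
        · refine definable₁_iff.2 ⟨(LHom.sumInl : L →ᴸ pairLanguage L).onFormula
            ((φ D).relabel (Sum.map (fun a : (Set.univ : Set S) => ⟨((a : S) : N), trivial⟩) id)), ?_⟩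
          ext x
          simp only [Option.elim_some, Set.mem_ofPred_eq, LHom.realize_onFormula,
            Formula.realize_relabel, Sum.elim_comp_map]
          rfl) (by
        classical
        intro s
        obtain ⟨x, hx⟩ := hFF ((↑) '' {D : F | some D ∈ s})
          (by rintro _ ⟨D, _, rfl⟩; exact D.2)
          ((s.finite_toSet.preimage (Option.some_injective _).injOn).image _)
        refine ⟨x, ?_⟩
        rintro (_ | D) hD
        · exact (hmem _).1 x.2
        · exact (hreal D x).1 (hx D ⟨D, hD, rfl⟩))
    refine ⟨⟨x, (hmem _).2 (hx none)⟩, fun D hD => ?_⟩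
    exact (hreal ⟨D, hD⟩ _).2 (hx (some ⟨D, hD⟩))
  · rw [hmem]
    intro hc'
    have h1 := hw' ((marker L).formula₁ (Term.var PUnit.unit))
    rw [realize_formula₁_iff, realize_formula₁_iff, hq₀] at h1
    exact hc (h1.2 hc')
  · rw [hS]
    rintro D hD ⟨x, hxD, hxP⟩
    obtain ⟨k, b, φ, hb, rfl⟩ := exists_formula_of_definable_insert hQ'ne hD
    have hψ : ∀ {K : Type u} [L.Structure K] (c : K) (b : Fin k → K) (x : K),
        (φ ⊓ P.formula₁ (Term.var (Sum.inr 0))).Realize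
          (Sum.elim (Sum.elim (fun _ => c) b) fun _ => x) ↔
          φ.Realize (Sum.elim (Sum.elim (fun _ => c) b) fun _ => x) ∧ x ∈ predSet P K := by
      intro K _ c b x
      rw [Formula.realize_inf, realize_formula₁_iff]
      rfl
    -- With P as a conjunct, the schema holds in N₀ exactly because of the hypothesis that P does
    -- not grow over c.
    obtain ⟨y, hyQ, hy⟩ := hax (φ ⊓ P.formula₁ (Term.var (Sum.inr 0))) (by
      rintro b hb ⟨x, hx⟩
      have hx := (hψ _ _ _).1 hx
      obtain ⟨y, hy, hyP, hyQ⟩ := h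
        {x | φ.Realize (Sum.elim (Sum.elim (fun _ => c) b) fun _ => x)} (by
          refine definable₁_iff.2 ⟨φ.relabel (Sum.map (Sum.elim
            (fun _ => ⟨c, Set.mem_insert _ _⟩) fun j => ⟨b j, Or.inr (hb j)⟩) id), ?_⟩
          ext x
          simp only [Set.mem_ofPred_eq, Formula.realize_relabel, Sum.elim_comp_map]
          refine iff_of_eq (congrArg _ ?_)
          funext i
          rcases i with (i | i) | i <;> rfl) ⟨x, hx.1, hx.2⟩
      exact ⟨y, hyQ, (hψ _ _ _).2 ⟨hy, hyP⟩⟩) b hb ⟨x, (hψ _ _ _).2 ⟨hxD, hxP⟩⟩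
    have hy := (hψ _ _ _).1 hy
    exact ⟨y, hy.1, hy.2, hyQ⟩

end Pairs

/-! ### Transfer along isomorphisms and equality of types -/

section Transfer

variable {L : FirstOrder.Language.{u, u}} {T : L.Theory} {P : L.Relations 1}

theorem DefCompact.of_equiv {M N : Type u} [L.Structure M] [L.Structure N] {κ : Cardinal.{u}}
    (hM : DefCompact L κ M) (e : M ≃[L] N) : DefCompact L κ N := by
  intro F hF hD hG
  obtain ⟨x, hx⟩ := hM.indexed (ι := F) hF (fun D => e ⁻¹' D.1) (by
    intro D
    obtain ⟨φ, hφ⟩ := definable₁_iff.1 (hD D D.2)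
    refine definable₁_iff.2 ⟨φ.relabel (Sum.map (fun a => ⟨e.symm a.1, trivial⟩) id), ?_⟩
    ext x
    rw [hφ]
    simp only [Set.mem_preimage, Set.mem_ofPred_eq, Formula.realize_relabel, Sum.elim_comp_map]
    refine Iff.trans (iff_of_eq (congrArg φ.Realize ?_)) (StrongHomClass.realize_formula e φ)
    funext i
    rcases i with i | i
    · simp
    · rfl) (by
    intro s
    obtain ⟨y, hy⟩ := hG (Subtype.val '' (s : Set F)) (by
      rintro _ ⟨D, _, rfl⟩
      exact D.2) (s.finite_toSet.image _)
    exact ⟨e.symm y, fun D hD => by simpa using hy D.1 ⟨D, hD, rfl⟩⟩)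
  exact ⟨e x, fun D hD => hx ⟨D, hD⟩⟩

theorem mem_satPartModels_of_equiv {κ : Cardinal.{u}} (hκ : theoryCard L < κ)
    {M₁ M₂ : Theory.ModelType.{u, u, u} T} (h : M₁ ∈ satPartModels T P κ)
    (e : predSet P M₁ ≃[relPart L] predSet P M₂) : M₂ ∈ satPartModels T P κ := by
  have hκ' := theoryCard_relPart_le.trans_lt hκ
  refine ⟨(Cardinal.mk_congr e.toEquiv).symm.trans h.1, ?_⟩
  exact (isKappaSaturated_iff_defCompact hκ').2
    (((isKappaSaturated_iff_defCompact hκ').1 h.2).of_equiv e)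

/-- An elementary substructure that contains the image of an elementary embedding without new
points in the predicate has an isomorphic `P`-part. -/
theorem exists_predSet_equiv {M N : Type u} [L.Structure M] [L.Structure N] (f : M ↪ₑ[L] N)
    (S : L.ElementarySubstructure N) (hfS : Set.range f ⊆ S)
    (hS : predSet P N ∩ S ⊆ Set.range f) :
    Nonempty (predSet P M ≃[relPart L] predSet P S) := by
  have hpred : ∀ x : S, x ∈ predSet P S ↔ (x : N) ∈ predSet P N :=
    fun x => (map_mem_predSet_iff S.subtype).symm
  let g : predSet P M → predSet P S := fun x =>
    ⟨⟨f x, hfS ⟨x, rfl⟩⟩, (hpred _).2 ((map_mem_predSet_iff f).2 x.2)⟩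
  have hg : Function.Bijective g := by
    refine ⟨fun x y hxy => ?_, fun y => ?_⟩
    · have h1 : f x = f y := congrArg (fun z : predSet P S => ((z : S) : N)) hxy
      exact Subtype.ext (f.injective h1)
    · obtain ⟨x, hx⟩ := hS ⟨(hpred y).1 y.2, (y : S).2⟩
      refine ⟨⟨x, (map_mem_predSet_iff f).1 ?_⟩, Subtype.ext (Subtype.ext hx)⟩
      rw [hx]
      exact (hpred y).1 y.2
  exact ⟨⟨Equiv.ofBijective g hg, fun φ => (φ : PEmpty).elim,
    fun {n} (R : L.Relations n) v => f.map_rel R fun i => (v i : M)⟩⟩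

theorem meetsDefinable_range {M N : Type u} [L.Structure M] [L.Structure N] (f : M ↪ₑ[L] N) :
    L.MeetsDefinable (Set.range f) := by
  intro D ⟨x, hx⟩ hD
  obtain ⟨φ, rfl⟩ := definable₁_iff.1 hD
  choose g hg using fun a : Set.range f => a.2
  let ψ : L.Formula M := Formula.iExs (Fin 1) (φ.relabel (Sum.map g id))
  have h1 : ∀ {K : Type u} [L.Structure K] (v : M → K), ψ.Realize v ↔
      ∃ x, φ.Realize (Sum.elim (v ∘ g) fun _ => x) := by
    intro K _ v
    simp only [ψ, Formula.realize_iExs, Formula.realize_relabel, Sum.elim_comp_map]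
    constructor
    · rintro ⟨u, hu⟩
      refine ⟨u 0, ?_⟩
      rwa [show u ∘ id = fun _ => u 0 from
        funext fun i => by rw [Subsingleton.elim i 0]; rfl] at hu
    · rintro ⟨x, hx⟩
      exact ⟨fun _ => x, hx⟩
  have hfg : f ∘ g = fun a : Set.range f => (a : N) := funext hg
  have h2 : ψ.Realize (f ∘ id) := (h1 _).2 ⟨x, by
    rw [Function.comp_id, hfg]
    exact hx⟩
  obtain ⟨y, hy⟩ := (h1 _).1 ((f.map_formula _ _).1 h2)
  refine ⟨f y, ?_, y, rfl⟩
  have h3 := (f.map_formula _ _).2 hy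
  rw [Sum.comp_elim, Function.id_comp, hfg] at h3
  exact h3

/-- Completeness of M ∪ {c} is visible in the type of c over M: χ says that a formula has a solution
in P, and θ that a given a ∈ M is one. -/
theorem PMeets.transfer {M N N' : Type u} [Nonempty M] [L.Structure M] [L.Structure N]
    [L.Structure N'] {i : M → N} {h : M → N'} {c : N} {c' : N'}
    (hcc : ∀ φ : L.Formula (M ⊕ Fin 1), φ.Realize (Sum.elim i fun _ => c) ↔
      φ.Realize (Sum.elim h fun _ => c'))
    (hc : PMeets P (insert c (Set.range i)) (predSet P N ∩ Set.range i)) :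
    PMeets P (insert c' (Set.range h)) (predSet P N' ∩ Set.range h) := by
  rintro D hD ⟨x, hxD, hxP⟩
  obtain ⟨k, b, φ, hb, rfl⟩ := exists_formula_of_definable_insert (Set.range_nonempty h) hD
  choose m hm using hb
  let χ : L.Formula (M ⊕ Fin 1) := Formula.iExs (Fin 1)
    (φ.relabel (Sum.map (Sum.elim (fun _ => Sum.inr 0) fun j => Sum.inl (m j)) id) ⊓
      P.formula₁ (Term.var (Sum.inr 0)))
  have hχ : ∀ {K : Type u} [L.Structure K] (g : M → K) (d : K),
      χ.Realize (Sum.elim g fun _ => d) ↔ ∃ x ∈ predSet P K,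
        φ.Realize (Sum.elim (Sum.elim (fun _ => d) (g ∘ m)) fun _ => x) := by
    intro K _ g d
    have hreal : ∀ u : Fin 1 → K, (Sum.elim (Sum.elim g fun _ => d) u ∘
        Sum.map (Sum.elim (fun _ : PUnit.{u + 1} => (Sum.inr 0 : M ⊕ Fin 1))
          fun j => Sum.inl (m j)) id) =
        Sum.elim (Sum.elim (fun _ => d) (g ∘ m)) fun _ => u 0 := by
      intro u
      funext j
      rcases j with (j | j) | j
      · rfl
      · rfl
      · rw [Subsingleton.elim j 0]
        rfl
    simp only [χ, Formula.realize_iExs, Formula.realize_inf, Formula.realize_relabel,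
      realize_formula₁_iff, hreal]
    exact ⟨fun ⟨u, hu⟩ => ⟨u 0, hu.2, hu.1⟩, fun ⟨x, hxP, hx⟩ => ⟨fun _ => x, hx, hxP⟩⟩
  have hbm : b = h ∘ m := funext fun j => (hm j).symm
  subst hbm
  obtain ⟨y, hyP, hy⟩ := (hχ i c).1 ((hcc χ).2 ((hχ h c').2 ⟨x, hxP, hxD⟩))
  obtain ⟨_, hz, hzP, a, rfl⟩ := hc
    {x | φ.Realize (Sum.elim (Sum.elim (fun _ => c) (i ∘ m)) fun _ => x)} (by
      refine definable₁_iff.2 ⟨φ.relabel (Sum.map (Sum.elim (fun _ => ⟨c, Set.mem_insert _ _⟩)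
        fun j => ⟨i (m j), Or.inr ⟨m j, rfl⟩⟩) id), ?_⟩
      ext x
      simp only [Set.mem_ofPred_eq, Formula.realize_relabel, Sum.elim_comp_map]
      refine iff_of_eq (congrArg _ ?_)
      funext i
      rcases i with (i | i) | i <;> rfl) ⟨y, hy, hyP⟩
  let θ : L.Formula (M ⊕ Fin 1) :=
    φ.relabel (Sum.elim (Sum.elim (fun _ => Sum.inr 0) fun j => Sum.inl (m j))
      fun _ => Sum.inl a) ⊓ P.formula₁ (Term.var (Sum.inl a))
  have hθ : ∀ {K : Type u} [L.Structure K] (g : M → K) (d : K),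
      θ.Realize (Sum.elim g fun _ => d) ↔
        φ.Realize (Sum.elim (Sum.elim (fun _ => d) (g ∘ m)) fun _ => g a) ∧
          g a ∈ predSet P K := by
    intro K _ g d
    rw [Formula.realize_inf, Formula.realize_relabel, realize_formula₁_iff]
    refine and_congr (iff_of_eq (congrArg _ ?_)) Iff.rfl
    funext j
    rcases j with (j | j) | j <;> rfl
  obtain ⟨h1, h2⟩ := (hθ h c').1 ((hcc θ).1 ((hθ i c).2 ⟨hz, hzP⟩))
  exact ⟨h a, h1, h2, a, rfl⟩

/-- The type has at most κ formulas and is finitely satisfiable along h by elementarity of i and h,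
so κ⁺-compactness applies. -/
theorem exists_realize_type {M N N' : Type u} [L.Structure M] [L.Structure N] [L.Structure N']
    {κ : Cardinal.{u}} (hκ : theoryCard L ≤ κ) (hM : #M ≤ κ)
    (hN' : DefCompact L (Order.succ κ) N') (i : M ↪ₑ[L] N) (h : M ↪ₑ[L] N') (c : N) :
    ∃ c' : N', ∀ φ : L.Formula (M ⊕ Fin 1), φ.Realize (Sum.elim i fun _ => c) ↔
      φ.Realize (Sum.elim h fun _ => c') := by
  have hconst : ∀ {K : Type u} (u : Fin 1 → K), u = fun _ => u 0 := fun u =>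
    funext fun i => by rw [Subsingleton.elim i 0]
  obtain ⟨c', hc'⟩ := hN'.exists_realize h
    {φ : L.Formula (M ⊕ Fin 1) | φ.Realize (Sum.elim i fun _ => c)}
    (Order.lt_succ_iff.2 ((Cardinal.mk_set_le _).trans (mk_formula_sum_le.trans (max_le hκ hM))))
    (by
      intro q hq
      let ψ : L.Formula M := Formula.iExs (Fin 1) (Formula.iInf fun φ : q => φ.1)
      have h1 : ψ.Realize (i ∘ id) := by
        rw [Formula.realize_iExs]
        refine ⟨fun _ => c, ?_⟩
        rw [Formula.realize_iInf]
        exact fun φ => hq φ.2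
      rw [i.map_formula, ← h.map_formula, Formula.realize_iExs] at h1
      obtain ⟨u, hu⟩ := h1
      rw [Formula.realize_iInf, hconst u] at hu
      exact ⟨u 0, fun φ hφ => hu ⟨φ, hφ⟩⟩)
  refine ⟨c', fun φ => ⟨hc' φ, fun hφ => by_contra fun hn => ?_⟩⟩
  exact hc' φ.not hn hφ

end Transfer

/-! ### Categoricity implies nulldimensionality -/

section Converse

variable {L : FirstOrder.Language.{u, u}} {T : L.Theory} {P : L.Relations 1}

/-- A tuple lying entirely in M would realize its own type there, so an omitted type in S_*(M) has a
coordinate outside M. Passing to that coordinate keeps the witnesses in P ∩ M. -/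
theorem exists_pMeets_insert_of_not_nulldimensional (h : ¬ Nulldimensional T P) :
    ∃ (M : Theory.ModelType.{u, u, u} T) (N : Type u) (_ : L.Structure N) (f : M ↪ₑ[L] N)
      (c : N), c ∉ Set.range f ∧
      PMeets P (insert c (Set.range f)) (predSet P N ∩ Set.range f) := by
  unfold Nulldimensional at h
  push Not at h
  obtain ⟨M, n, p, ⟨N, iN, f, c, rfl, hP, hc⟩, hp⟩ := h
  have : ∃ i, c i ∉ Set.range f := by
    by_contra! hall
    choose d hd using hall
    refine hp d ?_
    ext φ
    have h1 := f.map_formula φ (Sum.elim id d)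
    rw [Sum.comp_elim, funext hd (f := f ∘ d)] at h1
    exact h1
  obtain ⟨i, hi⟩ := this
  refine ⟨M, N, iN, f, c i, hi, ?_⟩
  have h1 := hc.pMeets
  rw [hP] at h1
  refine h1.anti (Set.insert_subset (Or.inr ⟨i, rfl⟩) Set.subset_union_left)

/-- If the predicate does not grow over some proper extension of a model of cardinality at most
`κ` with saturated `P`-part, then another such model with the same `P`-part is not isomorphic to
it over the predicate. -/
theorem not_categoricalOver (hT : StandingAssumptions T P) {κ : Cardinal.{u}}
    (hκ : theoryCard L < κ) (M : Theory.ModelType.{u, u, u} T) (hM : M ∈ satPartModels T P κ)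
    (hcard : #M ≤ κ) {N : Type u} [L.Structure N] (i : M ↪ₑ[L] N) {c : N}
    (hc : c ∉ Set.range i)
    (h : PMeets P (insert c (Set.range i)) (predSet P N ∩ Set.range i)) :
    ¬ CategoricalOver T P (satPartModels T P κ) := by
  intro hcat
  have h0 : ℵ₀ < κ := (le_max_left _ _).trans_lt hκ
  have hM0 : Nonempty M := inferInstance
  have hlt : Order.succ κ < 2 ^ (2 ^ κ : Cardinal.{u}) :=
    (Order.succ_le_of_lt (Cardinal.cantor κ)).trans_lt (Cardinal.cantor _)
  have hκθ : κ ≤ 2 ^ (2 ^ κ : Cardinal.{u}) := (Order.le_succ κ).trans hlt.le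
  -- The bound θ = 2^(2^κ) satisfies θ^κ = θ and lies strictly above κ⁺, so its regularity is not
  -- needed.
  obtain ⟨C, iC, w, -, hC, hw⟩ := exists_defCompact (L := L) (M := M) (Y := M) id
    (κ := Order.succ κ) (θ := 2 ^ (2 ^ κ : Cardinal.{u})) (hcard.trans hκθ) (hκ.le.trans hκθ)
    (h0.trans (Order.lt_succ κ)) hlt.le (Or.inl hlt) (by
      rw [Cardinal.powerlt_succ (Cardinal.power_ne_zero _ two_ne_zero), ← Cardinal.power_mul]
      have h2 : (2 : Cardinal.{u}) ^ κ * κ = 2 ^ κ :=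
        Cardinal.mul_eq_left (h0.le.trans (Cardinal.cantor κ).le) (Cardinal.cantor κ).le
          (Cardinal.aleph0_pos.trans h0).ne'
      rw [h2])
  let f : M ↪ₑ[L] C := elementaryOfFormulas w hw
  let C' : Theory.ModelType.{u, u, u} T := f.elementarilyEquivalent.toModel T
  -- A maximal elementary substructure above M with no new points of P. It has the same P-part as M,
  -- so categoricity applies to it.
  obtain ⟨m, hfm, hmax⟩ := zorn_subset_nonempty
    {X : Set C | Set.range f ⊆ X ∧ L.MeetsDefinable X ∧ predSet P C ∩ X ⊆ Set.range f} (by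
      intro K hK hchain hne
      refine ⟨⋃₀ K, ⟨?_, ?_, ?_⟩, fun X hX => Set.subset_sUnion_of_mem hX⟩
      · exact (hK hne.some_mem).1.trans (Set.subset_sUnion_of_mem hne.some_mem)
      · intro D hD hdef
        obtain ⟨X, hX, hXD⟩ := exists_definable_of_sUnion hne hchain hdef
        exact ((hK hX).2.1 D hD hXD).mono
          (Set.inter_subset_inter_right _ (Set.subset_sUnion_of_mem hX))
      · rintro x ⟨hxP, X, hX, hxX⟩
        exact (hK hX).2.2 ⟨hxP, hxX⟩) (Set.range f) ⟨le_rfl, meetsDefinable_range f, Set.inter_subset_right⟩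
  obtain ⟨-, hmd, hmP⟩ := hmax.prop
  let S : L.ElementarySubstructure C' := hmd.toElementarySubstructure
  have hS : (S : Set C') = m := hmd.closure_eq_self
  obtain ⟨e⟩ := exists_predSet_equiv (P := P) f S (hfm.trans hS.ge) ((Set.inter_subset_inter_right _ hS.le).trans hmP)
  have hM₂ : S.toModel T ∈ satPartModels T P κ := mem_satPartModels_of_equiv hκ hM e
  obtain ⟨g, -⟩ := hcat M hM (S.toModel T) hM₂ e
  let j : M ↪ₑ[L] C := S.subtype.comp g.toElementaryEmbedding
  have hj : Set.range j = m := by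
    rw [← hS]
    ext x
    constructor
    · rintro ⟨y, rfl⟩
      exact Subtype.property (p := (· ∈ S)) (g y)
    · intro hx
      obtain ⟨y, hy⟩ := g.surjective ⟨x, hx⟩
      exact ⟨y, congrArg Subtype.val hy⟩
  -- The isomorphism with M bounds the size of m by κ and carries the type of c to a type over m,
  -- realized in C.
  obtain ⟨c', hcc⟩ := exists_realize_type hκ.le hcard hC i j c
  have hmeet := h.transfer hcc
  rw [hj] at hmeet
  have hc' : c' ∉ m := by
    rw [← hj]
    rintro ⟨a, rfl⟩
    refine hc ⟨a, ?_⟩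
    have := (hcc ((Term.var (Sum.inl a)).equal (Term.var (Sum.inr 0)))).2 (by
      simp [Formula.realize_equal])
    simpa [Formula.realize_equal] using this
  have hSat := (isKappaSaturated_iff_defCompact (theoryCard_relPart_le.trans_lt hκ)).1 hM₂.2
  -- Closes m ∪ {c'} off to an elementary substructure without new points of P, contradicting
  -- maximality since c' ∉ m.
  obtain ⟨A', hAA', hA', hAd⟩ := exists_meetsDefinable (P := P) hκ hC
    (A := insert c' m) (B := predSet P C ∩ m) (fun A hBA hA =>
      pCompact_of_elementarySubstructure hT C' S hSat hA hBA
        (Set.inter_subset_right.trans hS.ge) Set.inter_subset_left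
        (Set.inter_subset_inter_right _ hS.le))
    (Set.inter_subset_right.trans (Set.subset_insert _ _)) (by
      refine Cardinal.mk_insert_le.trans (Cardinal.add_le_of_le h0.le ?_
        (Cardinal.one_lt_aleph0.trans h0).le)
      rw [← hj]
      exact Cardinal.mk_range_le.trans hcard) hmeet
  have hsub : m ⊆ A' := (Set.subset_insert _ _).trans hAA'
  have := hmax.le_of_ge (y := A') ⟨hfm.trans hsub, hAd, fun x hx => hmP (hA'.subset hx)⟩ hsub
  exact hc' (this (hAA' (Set.mem_insert _ _)))

/-- A failure may occur only at a model unrelated to κ. The compact pair moves it to a model of size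
κ with saturated P-part, where `not_categoricalOver` applies. -/
theorem Nulldimensional.of_categoricalOver (hT : StandingAssumptions T P) {κ : Cardinal.{u}}
    (hκ : theoryCard L < κ) (hpow : κ ^< κ = κ)
    (hcat : CategoricalOver T P (satPartModels T P κ)) : Nulldimensional T P := by
  by_contra hnd
  have h0 : ℵ₀ < κ := (le_max_left _ _).trans_lt hκ
  obtain ⟨M₀, N₀, _, f, c₀, hc₀, h⟩ := exists_pMeets_insert_of_not_nulldimensional hnd
  obtain ⟨N, _, S, c, hN, hcard, hS, hc, hmeet⟩ :=
    exists_compact_pair hκ hpow (Set.range_nonempty f) (meetsDefinable_range f) hc₀ h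
  let N' : Theory.ModelType.{u, u, u} T := (f.elementarilyEquivalent.trans hN).toModel T
  let S' : L.ElementarySubstructure N' := S
  have hSc : #S ≤ κ := (Cardinal.mk_subtype_le _).trans hcard
  have hSat : S'.toModel T ∈ satPartModels T P κ := by
    refine ⟨le_antisymm ((Cardinal.mk_set_le _).trans hSc) ?_, ?_⟩
    · exact DefCompact.le_mk (M := S) h0.le hS (definable₁_predSet P) (hT.infinite (S'.toModel T))
    · exact (isKappaSaturated_iff_defCompact (theoryCard_relPart_le.trans_lt hκ)).2
        (DefCompact.predSet (M := S) h0.le hS (nonempty_predSet hT (S'.toModel T)))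
  have hrange : Set.range S.subtype = S := Subtype.range_coe
  refine not_categoricalOver hT hκ (S'.toModel T) hSat hSc S.subtype (c := c) ?_ ?_ hcat
  · intro hcr
    exact hc (hrange.le hcr)
  · have h1 : PMeets P (insert c (Set.range S.subtype)) (predSet P N ∩ Set.range S.subtype) := by
      rw [hrange]
      exact hmeet
    exact h1

end Converse

end OverPredicate
-- The equivalences
theorem mainTheorem6 {L : FirstOrder.Language.{u, u}} (T : L.Theory) (P : L.Relations 1)
    (hT : OverPredicate.StandingAssumptions T P)
    (lam : Cardinal.{u}) (hlam : OverPredicate.theoryCard L < lam) (hpow : lam ^< lam = lam) :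
    List.TFAE [
      OverPredicate.Nulldimensional T P,
      -- the two conditions for the given cardinal
      ∀ M : FirstOrder.Language.Theory.ModelType.{u, u, u} T,
        OverPredicate.IsSaturatedOfCard (OverPredicate.relPart L) lam (OverPredicate.predSet P M) →
        OverPredicate.IsSaturatedOfCard L lam M,
      OverPredicate.CategoricalOver T P (OverPredicate.satPartModels T P lam),
      -- the same two conditions for all such cardinals together
      ∀ μ : Cardinal.{u}, OverPredicate.theoryCard L < μ → μ ^< μ = μ →
        ∀ M : FirstOrder.Language.Theory.ModelType.{u, u, u} T,
          OverPredicate.IsSaturatedOfCard (OverPredicate.relPart L) μ (OverPredicate.predSet P M) →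
          OverPredicate.IsSaturatedOfCard L μ M,
      OverPredicate.CategoricalOver T P
        {M | ∃ μ : Cardinal.{u}, OverPredicate.theoryCard L < μ ∧ μ ^< μ = μ ∧
          M ∈ OverPredicate.satPartModels T P μ}] := by
  have hext : ∀ μ : Cardinal.{u}, OverPredicate.theoryCard L < μ →
      ∀ M₁ M₂ : FirstOrder.Language.Theory.ModelType.{u, u, u} T,
      OverPredicate.IsSaturatedOfCard L μ M₁ → OverPredicate.IsSaturatedOfCard L μ M₂ →
      ∀ e : OverPredicate.predSet P M₁ ≃[OverPredicate.relPart L] OverPredicate.predSet P M₂,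
        ∃ g : M₁ ≃[L] M₂, ∀ x : OverPredicate.predSet P M₁, g (x : M₁) = (e x : M₂) :=
    fun μ hμ M₁ M₂ h₁ h₂ e => OverPredicate.exists_equiv_extending hT M₁ M₂ hμ
      ((OverPredicate.isKappaSaturated_iff_defCompact hμ).1 h₁.2)
      ((OverPredicate.isKappaSaturated_iff_defCompact hμ).1 h₂.2) h₁.1 h₂.1 e
  tfae_have 1 → 4 := fun h μ hμ _ M hM => h.isSaturatedOfCard hT hμ M hM
  tfae_have 4 → 2 := fun h => h lam hlam hpow
  tfae_have 4 → 5 := by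
    rintro h M₁ ⟨μ, hμ, hμp, h₁⟩ M₂ ⟨ν, hν, hνp, h₂⟩ e
    -- Isomorphic P-parts have the same size, so both models belong to the same cardinal.
    have hμν : μ = ν := h₁.1.symm.trans ((Cardinal.mk_congr e.toEquiv).trans h₂.1)
    subst hμν
    exact hext μ hμ M₁ M₂ (h μ hμ hμp M₁ h₁) (h μ hμ hμp M₂ h₂) e
  tfae_have 5 → 3 := fun h M₁ h₁ M₂ h₂ =>
    h M₁ ⟨lam, hlam, hpow, h₁⟩ M₂ ⟨lam, hlam, hpow, h₂⟩
  tfae_have 2 → 3 := fun h M₁ h₁ M₂ h₂ => hext lam hlam M₁ M₂ (h M₁ h₁) (h M₂ h₂)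
  tfae_have 3 → 1 := OverPredicate.Nulldimensional.of_categoricalOver hT hlam hpow
  tfae_finish
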